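/- Let $M$ be a smooth manifold of dimension $2\ell$ endowed with a conformal structure $c$, i.e. a class of smooth Riemannian metrics modulo the relation $g\sim e^{2\varphi}g$, $\varphi\in C^\infty(M)$. Let $I(T(M))\subset \mathrm{End}(T(M))$ be the bundle whose fibre over $x$ is the set of $J\in\mathrm{End}(T_xM)$ with $J^2=-1$, and let $H(T(M))\subset I(T(M))$ be the subset of those $J\in I(T(M))$, $J\in\mathrm{End}(T_xM)$, with $g_x(JX,JY)=g_x(X,Y)$ for all $X,Y\in T_xM$, for some metric $g$ in $c$. A linear connection $\nabla$ on $M$ splits the tangent space of $\mathrm{End}(T(M))$ at $J\in \mathrm{End}(T_xM)$ into horizontal vectors, identified with $T_xM$ by horizontal lift, and vertical vectors, identified with $\mathrm{End}(T_xM)$. The natural almost complex structure $j^\nabla$ of $I(T(M))$ is the restriction to the tangent spaces of $I(T(M))$, at points $J\in I(T(M))$, of the endomorphism which on horizontal vectors is the horizontal lift of $X\mapsto JX$ and on vertical vectors is $A\mapsto JA$ (the vertical vectors tangent to $I(T(M))$ at $J$ being the $A$ with $AJ+JA=0$). Then: (1) If $g$ and $g'$ are two Riemannian metrics in $c$, with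 Levi-Civita connections $\nabla$ and $\nabla'$, then $j^{\nabla}$ and $j^{\nabla'}$ coincide on the tangent space of $I(T(M))$ at $J$, for every $J\in H(T(M))$. (2) Hence $H(T(M))$, which is an embedded smooth submanifold of $\mathrm{End}(T(M))$, carries an almost complex structure that depends only on the conformal structure $c$: there is exactly one (smooth) almost complex structure $j$ on $H(T(M))$ such that, for every metric $g$ in $c$ with Levi-Civita connection $\nabla$, $j$ is the restriction of $j^\nabla$ to the tangent spaces of $H(T(M))$. -/

import Mathlib

open Bundle Manifold ContDiff

noncomputable section

namespace ConformalTwistor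

/-! ### Submanifolds of a manifold and almost complex structures on them -/

section Submanifold

variable {W : Type*} [NormedAddCommGroup W] [NormedSpace ℝ W]
  {HN : Type*} [TopologicalSpace HN] (IN : ModelWithCorners ℝ W HN)
  {N : Type*} [TopologicalSpace N] [ChartedSpace HN N]

/-- `S` is an embedded smooth submanifold of the manifold `N` (without boundary): around each of
its points there is a smooth diffeomorphism from an open set of `N` onto an open set of the model
vector space that maps `S` onto the trace of a vector subspace. -/
def IsEmbeddedSubmanifold (S : Set N) : Prop :=
  ∀ p ∈ S, ∃ (F : Submodule ℝ W) (φ : OpenPartialHomeomorph N W),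
    p ∈ φ.source ∧
    ContMDiffOn IN 𝓘(ℝ, W) ∞ φ φ.source ∧
    ContMDiffOn 𝓘(ℝ, W) IN ∞ φ.symm φ.target ∧
    ∀ q ∈ φ.source, q ∈ S ↔ φ q ∈ F

/-- The tangent space at `p` of a submanifold `S` of `N`, as a subspace of the tangent space of `N`
at `p`: it is spanned by the velocities at time `0` of the smooth curves in `S` that pass through
`p` at time `0`. -/
def tangentSubspace (S : Set N) (p : N) : Submodule ℝ (TangentSpace IN p) :=
  Submodule.span ℝ {v | ∃ ε > 0, ∃ γ : ℝ → N,
    ContMDiffOn 𝓘(ℝ, ℝ) IN ∞ γ (Set.Ioo (-ε) ε) ∧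
    (∀ t ∈ Set.Ioo (-ε) ε, γ t ∈ S) ∧
    (⟨γ 0, mfderiv 𝓘(ℝ, ℝ) IN γ 0 (1 : ℝ)⟩ : TangentBundle IN N) = ⟨p, v⟩}

/-- An almost complex structure on a submanifold `S` of `N`: a smooth field of endomorphisms of the
tangent spaces of `S` with square minus the identity. Smoothness on a submanifold means, as usual,
that the field is locally the restriction of a smooth field of endomorphisms of the tangent spaces
of `N`. -/
structure AlmostComplexStructureOn [IsManifold IN ∞ N] (S : Set N) where
  /-- The endomorphism of the tangent space at each point of `S`. -/
  toFun : ∀ p : S, tangentSubspace IN S (p : N) →ₗ[ℝ] tangentSubspace IN S (p : N)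
  sq_eq_neg : ∀ (p : S) (v : tangentSubspace IN S (p : N)), toFun p (toFun p v) = -v
  smooth : ∀ p : S, ∃ U : Set N, IsOpen U ∧ (p : N) ∈ U ∧
    ∃ Φ : ∀ q : N, TangentSpace IN q →L[ℝ] TangentSpace IN q,
      ContMDiffOn IN (IN.prod 𝓘(ℝ, W →L[ℝ] W)) ∞
        (fun q => TotalSpace.mk' (W →L[ℝ] W)
          (E := fun q : N => TangentSpace IN q →L[ℝ] TangentSpace IN q) q (Φ q)) U ∧
      ∀ q : S, (q : N) ∈ U → ∀ v : tangentSubspace IN S (q : N),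
        Φ q v = (toFun q v : TangentSpace IN (q : N))

end Submanifold

variable {E : Type*} [NormedAddCommGroup E] [NormedSpace ℝ E]
  {M : Type*} [TopologicalSpace M] [ChartedSpace E M]

/-! ### The bundle of endomorphisms of the tangent spaces -/

/-- The space of endomorphisms of the tangent space of `M` at `x`. -/
abbrev EndFiber (E : Type*) [NormedAddCommGroup E] [NormedSpace ℝ E]
    {M : Type*} [TopologicalSpace M] [ChartedSpace E M] (x : M) : Type _ :=
  TangentSpace 𝓘(ℝ, E) x →L[ℝ] TangentSpace 𝓘(ℝ, E) x

variable [IsManifold 𝓘(ℝ, E) ∞ M]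

variable (E M) in
/-- The total space of the smooth vector bundle `End(TM)`; its points are the pairs `⟨x, A⟩` with
`x` in `M` and `A` an endomorphism of the tangent space at `x`. -/
abbrev EndBundle := TotalSpace (E →L[ℝ] E) (fun x : M => EndFiber E x)

variable (E) in
/-- The model with corners of the manifold `End(TM)`. -/
abbrev endModel := 𝓘(ℝ, E).prod 𝓘(ℝ, E →L[ℝ] E)

variable (E M) in
/-- The bundle `I(TM)` of complex structures over `M`, as a subset of `End(TM)`: the pairs `⟨x, J⟩`
where `J` is an endomorphism of the tangent space at `x` with square minus the identity. -/
def complexStructures : Set (EndBundle E M) :=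
  {J | ∀ X : TangentSpace 𝓘(ℝ, E) J.1, J.2 (J.2 X) = -X}

/-! ### Metrics and conformal structures -/

variable (E M) in
/-- Smooth Riemannian metrics on `M`. -/
abbrev RiemMetric := ContMDiffRiemannianMetric 𝓘(ℝ, E) ∞ E (fun x : M => TangentSpace 𝓘(ℝ, E) x)

/-- Two metrics are conformally related if `g' = exp(2 φ) g` for a smooth function `φ`. -/
def ConformallyRelated (g g' : RiemMetric E M) : Prop :=
  ∃ φ : M → ℝ, ContMDiff 𝓘(ℝ, E) 𝓘(ℝ, ℝ) ∞ φ ∧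
    ∀ (x : M) (X Y : TangentSpace 𝓘(ℝ, E) x),
      g'.inner x X Y = Real.exp (2 * φ x) * g.inner x X Y

theorem conformallyRelated_equivalence :
    Equivalence (ConformallyRelated : RiemMetric E M → RiemMetric E M → Prop) where
  refl g := ⟨fun _ => 0, contMDiff_const, fun x X Y => by simp⟩
  symm := by
    rintro g g' ⟨φ, hφ, h⟩
    refine ⟨fun x => -φ x, hφ.neg, fun x X Y => ?_⟩
    rw [h, ← mul_assoc, ← Real.exp_add]
    simp
  trans := by
    rintro g g' g'' ⟨φ, hφ, h⟩ ⟨ψ, hψ, h'⟩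
    refine ⟨fun x => ψ x + φ x, hψ.add hφ, fun x X Y => ?_⟩
    rw [h', h, ← mul_assoc, ← Real.exp_add, mul_add]

variable (E M) in
/-- A conformal structure on `M`: a conformal class of Riemannian metrics. -/
def ConformalStructure :=
  Quotient (⟨ConformallyRelated, conformallyRelated_equivalence⟩ : Setoid (RiemMetric E M))

/-- The conformal structure induced by a metric. -/
def RiemMetric.conformalStructure (g : RiemMetric E M) : ConformalStructure E M :=
  Quotient.mk _ g

/-- The metric `g` is compatible with (i.e. induces) the conformal structure `c`. -/
def ConformalStructure.IsCompatible (c : ConformalStructure E M) (g : RiemMetric E M) : Prop :=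
  RiemMetric.conformalStructure g = c

/-- The bundle `H(TM)` of complex structures over `M` compatible with the conformal structure `c`:
the complex structures on tangent spaces that are isometric for a metric inducing `c`. -/
def isometricComplexStructures (c : ConformalStructure E M) : Set (EndBundle E M) :=
  {J | J ∈ complexStructures E M ∧ ∃ g : RiemMetric E M, c.IsCompatible g ∧
    ∀ X Y : TangentSpace 𝓘(ℝ, E) J.1, g.inner J.1 (J.2 X) (J.2 Y) = g.inner J.1 X Y}

/-! ### Linear connections and the splitting of the tangent bundle of `End(TM)` -/

variable (E M) in
/-- Linear connections on `M`, as covariant derivatives on the tangent bundle. For a vector field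
`Y` and a tangent vector `X` at `x`, the vector usually written `∇_X Y` is `D Y x X`. -/
abbrev LinearConnection :=
  CovariantDerivative 𝓘(ℝ, E) E (fun x : M => TangentSpace 𝓘(ℝ, E) x)

theorem endDeriv_tensorial (D : LinearConnection E M) (s : Π x : M, EndFiber E x) (x : M)
    (hs : MDifferentiableAt 𝓘(ℝ, E) (endModel E) (fun y => (⟨y, s y⟩ : EndBundle E M)) x)
    (X : TangentSpace 𝓘(ℝ, E) x) :
    TensorialAt 𝓘(ℝ, E) E (V := fun x : M => TangentSpace 𝓘(ℝ, E) x)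
      (fun Y : Π x : M, TangentSpace 𝓘(ℝ, E) x =>
        D (fun y => s y (Y y)) x X - s x (D Y x X)) x where
  smul {f Y} hf hY := by
    have h1 := D.isCovariantDerivativeOn.leibniz (MDifferentiableAt.clm_bundle_apply hs hY) hf
    have h2 := D.isCovariantDerivativeOn.leibniz hY hf
    have h3 : (fun y => s y ((f • Y) y)) = f • (fun y => s y (Y y)) := by
      ext y; simp
    rw [h3, h1, h2]
    simp
    module
  add {Y Z} hY hZ := by
    have h1 := D.isCovariantDerivativeOn.add (MDifferentiableAt.clm_bundle_apply hs hY)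
      (MDifferentiableAt.clm_bundle_apply hs hZ)
    have h2 := D.isCovariantDerivativeOn.add hY hZ
    have h3 : (fun y => s y ((Y + Z) y)) = (fun y => s y (Y y)) + (fun y => s y (Z y)) := by
      ext y; simp
    rw [h3, h1, h2]
    simp
    abel

/-- A smooth local section of `End(TM)` through the point `J` (it is constant in the preferred
trivialization around the base point of `J`). -/
def sectionThrough (J : EndBundle E M) (y : M) : EndFiber E y :=
  FiberBundle.extend (E →L[ℝ] E) (E := fun y : M => EndFiber E y) J.2 y

theorem sectionThrough_self (J : EndBundle E M) :
    (⟨J.1, sectionThrough J J.1⟩ : EndBundle E M) = J := by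
  simp [sectionThrough]

theorem sectionThrough_mdifferentiableAt (J : EndBundle E M) :
    MDifferentiableAt 𝓘(ℝ, E) (endModel E)
      (fun y => (⟨y, sectionThrough J y⟩ : EndBundle E M)) J.1 :=
  FiberBundle.mdifferentiableAt_extend 𝓘(ℝ, E) (E →L[ℝ] E) (V := fun y : M => EndFiber E y) J.2

/-- The velocity of `sectionThrough J` at the base point of `J`, as a map into the tangent space of
`End(TM)` at `J` (by `sectionThrough_self` the section takes the value `J` there). -/
def sectionThroughDeriv (J : EndBundle E M) :
    TangentSpace 𝓘(ℝ, E) J.1 →L[ℝ] TangentSpace (endModel E) J :=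
  mfderiv 𝓘(ℝ, E) (endModel E) (fun y : M => (⟨y, sectionThrough J y⟩ : EndBundle E M)) J.1

/-- The identification of the endomorphisms of the tangent space of `M` at `x` with the vertical
vectors at `J`, for `J` over `x`, i.e. the derivative at `J` of the inclusion of the fiber in `End(TM)`. -/
def verticalLift (J : EndBundle E M) :
    EndFiber E J.1 →L[ℝ] TangentSpace (endModel E) J :=
  mfderiv 𝓘(ℝ, E →L[ℝ] E) (endModel E) (fun A : E →L[ℝ] E => (⟨J.1, A⟩ : EndBundle E M)) J.2

theorem contMDiff_fiber_inclusion (x : M) :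
    ContMDiff 𝓘(ℝ, E →L[ℝ] E) (endModel E) ∞
      (fun A : E →L[ℝ] E => (⟨x, A⟩ : EndBundle E M)) := by
  intro A
  rw [contMDiffAt_totalSpace]
  refine ⟨contMDiffAt_const, ?_⟩
  have h : (fun A : E →L[ℝ] E =>
      (trivializationAt (E →L[ℝ] E) (fun x : M => EndFiber E x) x ⟨x, A⟩).2) =
      (Bundle.Trivialization.continuousLinearEquivAt ℝ
        (trivializationAt (E →L[ℝ] E) (fun x : M => EndFiber E x) x) x
        (FiberBundle.mem_baseSet_trivializationAt' x) : EndFiber E x →L[ℝ] (E →L[ℝ] E)) := by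
    ext A; rfl
  change ContMDiffAt _ _ _ (fun A : E →L[ℝ] E =>
      (trivializationAt (E →L[ℝ] E) (fun x : M => EndFiber E x) x ⟨x, A⟩).2) A
  rw [h]
  exact (ContinuousLinearMap.contDiff (𝕜 := ℝ) (E := E →L[ℝ] E) (F := E →L[ℝ] E) _).contMDiff A

theorem hasMFDerivAt_fiber_inclusion (J : EndBundle E M) :
    HasMFDerivAt 𝓘(ℝ, E →L[ℝ] E) (endModel E)
      (fun A : E →L[ℝ] E => (⟨J.1, A⟩ : EndBundle E M)) J.2 (verticalLift J) :=
  ((contMDiff_fiber_inclusion (E := E) J.1).mdifferentiable (by simp) _).hasMFDerivAt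

theorem verticalLift_injective (J : EndBundle E M) : Function.Injective (verticalLift J) := by
  have h := hasMFDerivAt_fiber_inclusion J
  let e := trivializationAt (E →L[ℝ] E) (fun x : M => EndFiber E x) J.1
  let L : EndFiber E J.1 ≃L[ℝ] (E →L[ℝ] E) :=
    e.continuousLinearEquivAt ℝ J.1 (FiberBundle.mem_baseSet_trivializationAt' J.1)
  have h1 : ContMDiffAt (endModel E) 𝓘(ℝ, E →L[ℝ] E) ∞ (fun p : EndBundle E M => (e p).2) J :=
    (contMDiffAt_totalSpace.1 (contMDiffAt_id (x := J))).2
  have h2 := HasMFDerivAt.comp (f := fun A : E →L[ℝ] E => (⟨J.1, A⟩ : EndBundle E M)) _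
    (h1.mdifferentiableAt (by simp)).hasMFDerivAt h
  have h3 : HasMFDerivAt 𝓘(ℝ, E →L[ℝ] E) 𝓘(ℝ, E →L[ℝ] E)
      (fun A : E →L[ℝ] E => (L : EndFiber E J.1 →L[ℝ] E →L[ℝ] E) A) J.2
      (L : EndFiber E J.1 →L[ℝ] E →L[ℝ] E) :=
    (ContinuousLinearMap.hasFDerivAt (𝕜 := ℝ) (E := E →L[ℝ] E) (F := E →L[ℝ] E)
      (L : EndFiber E J.1 →L[ℝ] E →L[ℝ] E)).hasMFDerivAt
  have h4 := hasMFDerivAt_unique h2 h3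
  have key : ∀ A : EndFiber E J.1,
      mfderiv (endModel E) 𝓘(ℝ, E →L[ℝ] E) (fun p : EndBundle E M => (e p).2) J
        (verticalLift J A) = L A :=
    fun A => congrArg (fun f => f A) h4
  intro A B hAB
  apply L.injective
  rw [← key A, ← key B, hAB]

/-- The derivative at `J` of the bundle projection `End(TM) → M`. -/
def projDeriv (J : EndBundle E M) :
    TangentSpace (endModel E) J →L[ℝ] TangentSpace 𝓘(ℝ, E) J.1 :=
  mfderiv (endModel E) 𝓘(ℝ, E) (TotalSpace.proj : EndBundle E M → M) J

theorem hasMFDerivAt_proj (J : EndBundle E M) :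
    HasMFDerivAt (endModel E) 𝓘(ℝ, E) (TotalSpace.proj : EndBundle E M → M) J (projDeriv J) :=
  (((contMDiff_proj (n := ∞) (fun x : M => EndFiber E x)).mdifferentiable (by simp)) J).hasMFDerivAt
    (I := endModel E) (I' := 𝓘(ℝ, E))

theorem projDeriv_verticalLift (J : EndBundle E M) (A : EndFiber E J.1) :
    projDeriv J (verticalLift J A) = 0 := by
  have h2 := HasMFDerivAt.comp (f := fun A : E →L[ℝ] E => (⟨J.1, A⟩ : EndBundle E M)) _
    (hasMFDerivAt_proj J) (hasMFDerivAt_fiber_inclusion J)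
  have h3 := hasMFDerivAt_const (I := 𝓘(ℝ, E →L[ℝ] E)) (I' := 𝓘(ℝ, E)) J.1
    (show E →L[ℝ] E from J.2)
  exact congrArg (fun f => f A) (hasMFDerivAt_unique h2 h3)

theorem projDeriv_sectionThroughDeriv (J : EndBundle E M) (X : TangentSpace 𝓘(ℝ, E) J.1) :
    projDeriv J (sectionThroughDeriv J X) = X := by
  have h := (sectionThrough_mdifferentiableAt J).hasMFDerivAt
  have h1 := hasMFDerivAt_proj J
  rw [← sectionThrough_self J] at h1
  have h2 := HasMFDerivAt.comp (f := (fun y => (⟨y, sectionThrough J y⟩ : EndBundle E M)))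
    J.1 h1 h
  have h3 := hasMFDerivAt_id (I := 𝓘(ℝ, E)) J.1
  have h5 : projDeriv ⟨J.1, sectionThrough J J.1⟩ (mfderiv 𝓘(ℝ, E) (endModel E)
      (fun y : M => (⟨y, sectionThrough J y⟩ : EndBundle E M)) J.1 X) = X :=
    congrArg (fun f => f X) (hasMFDerivAt_unique h2 h3)
  rw [sectionThrough_self] at h5
  exact h5

variable [FiniteDimensional ℝ E]

/-- The connection induced by `D` on `End(TM)`: for a section `s` of `End(TM)` that is
differentiable at `x`, the covariant derivative `∇_X s` is the endomorphism
`Y ↦ ∇_X (s Y) - s (∇_X Y)` of the tangent space at `x`. -/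
def endDeriv (D : LinearConnection E M) (s : Π x : M, EndFiber E x) (x : M)
    (hs : MDifferentiableAt 𝓘(ℝ, E) (endModel E) (fun y => (⟨y, s y⟩ : EndBundle E M)) x) :
    TangentSpace 𝓘(ℝ, E) x →ₗ[ℝ] EndFiber E x where
  toFun X := TensorialAt.mkHom _ x (endDeriv_tensorial D s x hs X)
  map_add' X X' := by
    ext Y
    simp [TensorialAt.mkHom_apply_eq_extend]
    abel
  map_smul' c X := by
    ext Y
    simp [TensorialAt.mkHom_apply_eq_extend, smul_sub]

/-- The horizontal lift at `J` for the connection `D`: the lift of `X` is `ds(X)` minus the vertical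
vector `∇_X s`, where `s` is a section of `End(TM)` through `J` (the result does not depend on `s`).
In particular it is `ds(X)` if `∇_X s = 0`. -/
def horizontalLift (D : LinearConnection E M) (J : EndBundle E M) :
    TangentSpace 𝓘(ℝ, E) J.1 →ₗ[ℝ] TangentSpace (endModel E) J :=
  (sectionThroughDeriv J).toLinearMap - (verticalLift J).toLinearMap ∘ₗ
    endDeriv D (sectionThrough J) J.1 (sectionThrough_mdifferentiableAt J)

theorem projDeriv_horizontalLift (D : LinearConnection E M) (J : EndBundle E M)
    (X : TangentSpace 𝓘(ℝ, E) J.1) : projDeriv J (horizontalLift D J X) = X := by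
  have h : horizontalLift D J X = sectionThroughDeriv J X - verticalLift J
      (endDeriv D (sectionThrough J) J.1 (sectionThrough_mdifferentiableAt J) X) := rfl
  rw [h, ContinuousLinearMap.map_sub, projDeriv_sectionThroughDeriv, projDeriv_verticalLift,
    sub_zero]

theorem splitting_injective (D : LinearConnection E M) (J : EndBundle E M) :
    Function.Injective ((horizontalLift D J).coprod (verticalLift J).toLinearMap) := by
  rw [← LinearMap.ker_eq_bot, LinearMap.ker_eq_bot']
  rintro ⟨X, A⟩ h
  have h' : horizontalLift D J X + verticalLift J A = 0 := h
  have hX : X = 0 := by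
    have h1 := congrArg (projDeriv J) h'
    rwa [ContinuousLinearMap.map_add, projDeriv_horizontalLift, projDeriv_verticalLift, add_zero,
      ContinuousLinearMap.map_zero] at h1
  subst hX
  rw [LinearMap.map_zero, zero_add] at h'
  rw [verticalLift_injective J (h'.trans (ContinuousLinearMap.map_zero _).symm)]
  rfl

/-- The splitting of the tangent space of `End(TM)` at `J` into horizontal and vertical vectors
for the connection `D`: it sends `(X, A)` to the sum of the horizontal lift of `X` and the vertical
vector `A`. -/
def splitting (D : LinearConnection E M) (J : EndBundle E M) :
    (TangentSpace 𝓘(ℝ, E) J.1 × EndFiber E J.1) ≃ₗ[ℝ] TangentSpace (endModel E) J :=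
  haveI : FiniteDimensional ℝ (TangentSpace 𝓘(ℝ, E) J.1 × EndFiber E J.1) :=
    inferInstanceAs (FiniteDimensional ℝ (E × (E →L[ℝ] E)))
  haveI : FiniteDimensional ℝ (TangentSpace (endModel E) J) :=
    inferInstanceAs (FiniteDimensional ℝ (E × (E →L[ℝ] E)))
  LinearEquiv.ofInjectiveOfFinrankEq
    ((horizontalLift D J).coprod (verticalLift J).toLinearMap) (splitting_injective D J) rfl

theorem splitting_apply (D : LinearConnection E M) (J : EndBundle E M)
    (X : TangentSpace 𝓘(ℝ, E) J.1) (A : EndFiber E J.1) :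
    splitting D J (X, A) = horizontalLift D J X + verticalLift J A := rfl

/-- The endomorphism `A ↦ J A` of the space of endomorphisms of a tangent space. -/
def leftComp {x : M} (J : EndFiber E x) : EndFiber E x →ₗ[ℝ] EndFiber E x where
  toFun A := J ∘L A
  map_add' A B := by ext; simp
  map_smul' c A := by ext; simp

/-- The natural almost complex structure associated to the linear connection `D`, at the point `J`:
on horizontal vectors it is the horizontal lift of `J`, on vertical vectors it is `A ↦ J A`.
The natural almost complex structure of `I(TM)` at a complex structure `J` is the restriction of
this operator to the tangent space of `I(TM)` at `J`, whose vertical vectors are the endomorphisms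
`A` with `A J + J A = 0`. -/
def naturalComplexStructure (D : LinearConnection E M) (J : EndBundle E M) :
    TangentSpace (endModel E) J →ₗ[ℝ] TangentSpace (endModel E) J :=
  (splitting D J).toLinearMap ∘ₗ
    (LinearMap.prodMap (J.2.toLinearMap) (leftComp J.2)) ∘ₗ (splitting D J).symm.toLinearMap

theorem naturalComplexStructure_apply (D : LinearConnection E M) (J : EndBundle E M)
    (X : TangentSpace 𝓘(ℝ, E) J.1) (A : EndFiber E J.1) :
    naturalComplexStructure D J (horizontalLift D J X + verticalLift J A) =
      horizontalLift D J (J.2 X) + verticalLift J (J.2 ∘L A) := by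
  rw [← splitting_apply, ← splitting_apply]
  change splitting D J (LinearMap.prodMap (J.2.toLinearMap) (leftComp J.2)
    ((splitting D J).symm (splitting D J (X, A)))) = _
  rw [LinearEquiv.symm_apply_apply]
  rfl

/-! ### Riemannian connections -/

/-- `D` is the Riemannian (Levi-Civita) connection of the metric `g`: it has no torsion and is
compatible with `g`. -/
def IsLeviCivita (g : RiemMetric E M) (D : LinearConnection E M) : Prop :=
  D.torsion = 0 ∧
    letI : RiemannianBundle (fun x : M => TangentSpace 𝓘(ℝ, E) x) := ⟨g.toRiemannianMetric⟩
    CovariantDerivative.IsMetricCompatible (F := E) (V := fun x : M => TangentSpace 𝓘(ℝ, E) x) D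

end ConformalTwistor

end

open ConformalTwistor

/-!
If `g' = exp(2 φ) g`, the Levi-Civita connections of `g` and `g'` differ by the symmetric tensor
`A u v = θ(u) v + θ(v) u - g(u, v) θ♯` with `θ = dφ`. For an isometric complex structure `a`, the
commutators `[A u, a]` satisfy `[A (a u), a] = a [A u, a]`, and this is exactly what makes the
correction terms of the two horizontal lifts cancel in the natural almost complex structures.

A smooth isometric frame makes the metric constant, and the Cayley transform at a given isometric
complex structure then turns the isometric complex structures nearby into a vector space: those
skew endomorphisms that anticommute with the given one. This makes `H(TM)` a submanifold. Along
a curve in `H(TM)` the vertical part of the velocity is skew and anticommutes with the complex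
structure, and by equality of dimensions all such vectors are tangent to `H(TM)`. For such a
vertical part `b`, the product `a b` is again skew and anticommutes with `a`, so the natural almost
complex structure preserves the tangent spaces.
-/

noncomputable section

set_option maxSynthPendingDepth 3

namespace ConformalTwistor

open Filter Topology

/-! ### Isometric complex structures of a bilinear form -/

section Anticommutant

variable (R : Type*) {A : Type*} [CommRing R] [Ring A] [Algebra R A]

/-- The elements of an algebra that anticommute with `a`. For a complex structure `a`, these are the
tangent vectors at `a` to the set of all complex structures. -/
def anticommutant (a : A) : Submodule R A :=
  LinearMap.ker (LinearMap.mulLeft R a + LinearMap.mulRight R a)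

variable {R}

theorem mem_anticommutant {a b : A} : b ∈ anticommutant R a ↔ a * b + b * a = 0 := Iff.rfl

theorem mul_mem_anticommutant {a b : A} (hb : b ∈ anticommutant R a) :
    a * b ∈ anticommutant R a := by
  rw [mem_anticommutant] at *
  rw [mul_assoc, ← mul_add, hb, mul_zero]

theorem commutator_mem_anticommutant {a : A} (ha : a * a = -1) (c : A) :
    c * a - a * c ∈ anticommutant R a := by
  rw [mem_anticommutant, mul_sub, sub_mul, ← mul_assoc a a, mul_assoc c, ha]
  noncomm_ring

end Anticommutant

section Skew

variable {𝕜 E : Type*} [NontriviallyNormedField 𝕜] [NormedAddCommGroup E] [NormedSpace 𝕜 E]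
  {β : E →L[𝕜] E →L[𝕜] 𝕜} {a b : E →L[𝕜] E}

/-- The continuous endomorphisms that are skew for the bilinear form `β`. -/
def skewEnd (β : E →L[𝕜] E →L[𝕜] 𝕜) : Submodule 𝕜 (E →L[𝕜] E) where
  carrier := {b | ∀ v w, β (b v) w + β v (b w) = 0}
  add_mem' {b c} hb hc v w := by
    simp only [add_apply, map_add]
    linear_combination hb v w + hc v w
  zero_mem' v w := by simp
  smul_mem' r b hb v w := by
    simp only [smul_apply, map_smul, smul_eq_mul]
    linear_combination r * hb v w

theorem mul_mem_skewEnd (ha : a ∈ skewEnd β) (hb : b ∈ skewEnd β)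
    (hab : b ∈ anticommutant 𝕜 a) : a * b ∈ skewEnd β := by
  intro v w
  have hw : a (b w) = -b (a w) := eq_neg_of_add_eq_zero_left (congrArg (fun f => f w) hab)
  simp only [mul_apply_eq_comp, hw, map_neg]
  linear_combination ha (b v) w - hb v (a w)

/-- The complex structures that are isometries of the bilinear form `β`. -/
structure IsIsometricComplex (β : E →L[𝕜] E →L[𝕜] 𝕜) (a : E →L[𝕜] E) : Prop where
  sq_eq : a * a = -1
  isometric : ∀ v w, β (a v) (a w) = β v w

theorem IsIsometricComplex.apply_apply (ha : IsIsometricComplex β a) (v : E) : a (a v) = -v :=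
  congrArg (fun f => f v) ha.sq_eq

theorem IsIsometricComplex.mem_skewEnd (ha : IsIsometricComplex β a) : a ∈ skewEnd β := by
  intro v w
  have h := ha.isometric v (a w)
  rw [ha.apply_apply, map_neg] at h
  linear_combination -h

theorem isIsometricComplex_conj_of_isometric {β₀ : E →L[𝕜] E →L[𝕜] 𝕜} {p q : E →L[𝕜] E}
    (hpq : p * q = 1) (hqp : q * p = 1) (hβ : ∀ v w, β (p v) (p w) = β₀ v w)
    (ha : IsIsometricComplex β a) : IsIsometricComplex β₀ (q * a * p) := by
  refine ⟨?_, fun v w => ?_⟩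
  · calc q * a * p * (q * a * p) = q * a * (p * q) * a * p := by noncomm_ring
      _ = q * (a * a) * p := by rw [hpq]; noncomm_ring
      _ = -(q * p) := by rw [ha.sq_eq]; noncomm_ring
      _ = -1 := by rw [hqp]
  · have hpq' (x : E) : p (q x) = x := congrArg (fun f => f x) hpq
    simp only [← hβ, mul_apply_eq_comp, hpq', ha.isometric]

theorem isIsometricComplex_conj_iff {β₀ : E →L[𝕜] E →L[𝕜] 𝕜} {p q : E →L[𝕜] E}
    (hpq : p * q = 1) (hqp : q * p = 1) (hβ : ∀ v w, β (p v) (p w) = β₀ v w) :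
    IsIsometricComplex β₀ (q * a * p) ↔ IsIsometricComplex β a := by
  refine ⟨fun h => ?_, isIsometricComplex_conj_of_isometric hpq hqp hβ⟩
  have hpq' (x : E) : p (q x) = x := congrArg (fun f => f x) hpq
  have hβ' (v w : E) : β₀ (q v) (q w) = β v w := by rw [← hβ, hpq', hpq']
  convert isIsometricComplex_conj_of_isometric hqp hpq hβ' h using 1
  calc a = p * q * a * (p * q) := by rw [hpq, one_mul, mul_one]
    _ = p * (q * a * p) * q := by noncomm_ring

end Skew

/-! ### The natural almost complex structure in coordinates -/

section Model

variable {𝕜 E : Type*} [NontriviallyNormedField 𝕜] [NormedAddCommGroup E] [NormedSpace 𝕜 E]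

/-- The Christoffel symbol `u ↦ [Γ u, a]` at `a` of the connection on endomorphisms that is induced
by the connection with Christoffel symbol `Γ`. -/
def inducedSymbol (Γ : E →L[𝕜] E →L[𝕜] E) (a : E →L[𝕜] E) : E →L[𝕜] E →L[𝕜] E :=
  ((ContinuousLinearMap.mul 𝕜 (E →L[𝕜] E)).flip a - ContinuousLinearMap.mul 𝕜 (E →L[𝕜] E) a) ∘L Γ

theorem inducedSymbol_apply (Γ : E →L[𝕜] E →L[𝕜] E) (a : E →L[𝕜] E) (u : E) :
    inducedSymbol Γ a u = Γ u * a - a * Γ u := rfl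

/-- The vertical component, for the connection with Christoffel symbol `Γ`, of a tangent vector
to `E × End E` at a point with second component `a`. -/
def verticalPart (Γ : E →L[𝕜] E →L[𝕜] E) (a : E →L[𝕜] E) :
    E × (E →L[𝕜] E) →L[𝕜] E →L[𝕜] E :=
  .snd 𝕜 E (E →L[𝕜] E) + inducedSymbol Γ a ∘L .fst 𝕜 E (E →L[𝕜] E)

theorem verticalPart_apply (Γ : E →L[𝕜] E →L[𝕜] E) (a : E →L[𝕜] E) (w : E × (E →L[𝕜] E)) :
    verticalPart Γ a w = w.2 + inducedSymbol Γ a w.1 := rfl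

theorem ext_verticalPart {Γ : E →L[𝕜] E →L[𝕜] E} {a : E →L[𝕜] E} {w w' : E × (E →L[𝕜] E)}
    (h₁ : w.1 = w'.1) (h₂ : verticalPart Γ a w = verticalPart Γ a w') : w = w' := by
  rw [verticalPart_apply, verticalPart_apply, h₁] at h₂
  exact Prod.ext h₁ (add_right_cancel h₂)

/-- The natural almost complex structure of the connection with Christoffel symbol `Γ`, on the
tangent space to `E × End E` at a point with second component `a`: it is left multiplication by `a`
on both the horizontal component `w.1` and the vertical component `verticalPart Γ a w`. -/
def modelComplexStructure (Γ : E →L[𝕜] E →L[𝕜] E) (a : E →L[𝕜] E) :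
    E × (E →L[𝕜] E) →L[𝕜] E × (E →L[𝕜] E) :=
  (a ∘L .fst 𝕜 E (E →L[𝕜] E)).prod
    (ContinuousLinearMap.mul 𝕜 (E →L[𝕜] E) a ∘L verticalPart Γ a -
      inducedSymbol Γ a ∘L a ∘L .fst 𝕜 E (E →L[𝕜] E))

theorem modelComplexStructure_apply (Γ : E →L[𝕜] E →L[𝕜] E) (a : E →L[𝕜] E)
    (w : E × (E →L[𝕜] E)) : modelComplexStructure Γ a w =
      (a w.1, a * verticalPart Γ a w - inducedSymbol Γ a (a w.1)) := rfl

theorem verticalPart_modelComplexStructure (Γ : E →L[𝕜] E →L[𝕜] E) (a : E →L[𝕜] E)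
    (w : E × (E →L[𝕜] E)) :
    verticalPart Γ a (modelComplexStructure Γ a w) = a * verticalPart Γ a w := by
  rw [modelComplexStructure_apply, verticalPart_apply, sub_add_cancel]

theorem contDiff_modelComplexStructure {n : WithTop ℕ∞} :
    ContDiff 𝕜 n (fun p : (E →L[𝕜] E →L[𝕜] E) × (E →L[𝕜] E) =>
      modelComplexStructure p.1 p.2) := by
  have hmul : ContDiff 𝕜 n fun p : (E →L[𝕜] E →L[𝕜] E) × (E →L[𝕜] E) =>
      ContinuousLinearMap.mul 𝕜 (E →L[𝕜] E) p.2 :=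
    (ContinuousLinearMap.contDiff _).comp contDiff_snd
  have hsymbol : ContDiff 𝕜 n fun p : (E →L[𝕜] E →L[𝕜] E) × (E →L[𝕜] E) =>
      inducedSymbol p.1 p.2 :=
    (((ContinuousLinearMap.contDiff _).comp contDiff_snd).sub hmul).clm_comp contDiff_fst
  have hfst : ContDiff 𝕜 n fun p : (E →L[𝕜] E →L[𝕜] E) × (E →L[𝕜] E) =>
      p.2 ∘L .fst 𝕜 E (E →L[𝕜] E) := contDiff_snd.clm_comp contDiff_const
  have hvertical : ContDiff 𝕜 n fun p : (E →L[𝕜] E →L[𝕜] E) × (E →L[𝕜] E) =>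
      verticalPart p.1 p.2 := contDiff_const.add (hsymbol.clm_comp contDiff_const)
  exact (ContinuousLinearMap.prodₗᵢ 𝕜).toContinuousLinearEquiv.contDiff.comp
    (hfst.prodMk ((hmul.clm_comp hvertical).sub (hsymbol.clm_comp hfst)))

/-- The space of the tangent vectors at `a` to the set of complex structures that are isometric for
a field of bilinear forms with value `β`, seen through a metric connection with Christoffel symbol
`Γ`: the vertical component is skew and anticommutes with `a`. -/
def modelTangent (β : E →L[𝕜] E →L[𝕜] 𝕜) (Γ : E →L[𝕜] E →L[𝕜] E) (a : E →L[𝕜] E) :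
    Submodule 𝕜 (E × (E →L[𝕜] E)) :=
  (anticommutant 𝕜 a ⊓ skewEnd β).comap (verticalPart Γ a).toLinearMap

variable {β : E →L[𝕜] E →L[𝕜] 𝕜} {Γ : E →L[𝕜] E →L[𝕜] E} {a : E →L[𝕜] E}

theorem mem_modelTangent {w : E × (E →L[𝕜] E)} : w ∈ modelTangent β Γ a ↔
    verticalPart Γ a w ∈ anticommutant 𝕜 a ∧ verticalPart Γ a w ∈ skewEnd β := Iff.rfl

theorem modelComplexStructure_mem_modelTangent (ha : IsIsometricComplex β a)
    {w : E × (E →L[𝕜] E)} (hw : w ∈ modelTangent β Γ a) :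
    modelComplexStructure Γ a w ∈ modelTangent β Γ a := by
  rw [mem_modelTangent, verticalPart_modelComplexStructure]
  exact ⟨mul_mem_anticommutant hw.1, mul_mem_skewEnd ha.mem_skewEnd hw.2 hw.1⟩

end Model

/-! ### Christoffel symbols of metrics and conformal invariance -/

section Christoffel

variable {E : Type*} [NormedAddCommGroup E] [NormedSpace ℝ E]

/-- `Γ` is the Christoffel symbol of the Levi-Civita connection of a metric with value `β` and
derivative `β'` at a point. -/
structure IsLeviCivitaSymbol (β : E →L[ℝ] E →L[ℝ] ℝ) (β' : E →L[ℝ] E →L[ℝ] E →L[ℝ] ℝ)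
    (Γ : E →L[ℝ] E →L[ℝ] E) : Prop where
  symm : ∀ u v, Γ u v = Γ v u
  metric : ∀ u v w, β' u v w = β (Γ u v) w + β v (Γ u w)

/-- Inner products on `E`, not necessarily related to the norm of `E`. -/
structure IsMetricForm (β : E →L[ℝ] E →L[ℝ] ℝ) : Prop where
  symm : ∀ v w, β v w = β w v
  pos : ∀ v, v ≠ 0 → 0 < β v v

variable {β : E →L[ℝ] E →L[ℝ] ℝ} {β' : E →L[ℝ] E →L[ℝ] E →L[ℝ] ℝ} {Γ Γ' : E →L[ℝ] E →L[ℝ] E}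

theorem IsMetricForm.ext (hβ : IsMetricForm β) {v v' : E} (h : ∀ w, β v w = β v' w) :
    v = v' := by
  by_contra hne
  refine (hβ.pos _ (sub_ne_zero.2 hne)).ne' ?_
  simp only [map_sub β, sub_apply, h, sub_self]

theorem IsLeviCivitaSymbol.koszul (hΓ : IsLeviCivitaSymbol β β' Γ) (hβ : ∀ v w, β v w = β w v)
    (u v w : E) : β (Γ u v) w = (β' u v w + β' v u w - β' w u v) / 2 := by
  rw [hΓ.metric u v w, hΓ.metric v u w, hΓ.metric w u v, hΓ.symm w u, hΓ.symm w v, hΓ.symm v u,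
    hβ u (Γ v w), hβ v (Γ u w)]
  ring

theorem IsLeviCivitaSymbol.sub_of_conformal (hΓ : IsLeviCivitaSymbol β β' Γ) {r : ℝ} (hr : r ≠ 0)
    {θ : E →L[ℝ] ℝ} (hΓ' : IsLeviCivitaSymbol (r • β) (r • ((2 • θ).smulRight β + β')) Γ') :
    IsLeviCivitaSymbol β ((2 • θ).smulRight β) (Γ' - Γ) where
  symm u v := by simp only [sub_apply, hΓ.symm u v, hΓ'.symm u v]
  metric u v w := by
    have h := hΓ'.metric u v w
    simp only [smul_apply, smul_eq_mul, add_apply, ← mul_add] at h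
    have h := mul_left_cancel₀ hr h
    simp only [sub_apply, map_sub]
    linear_combination h - hΓ.metric u v w

/-- The difference tensor of two conformal metrics is `A u v = θ u • v + θ v • u - β u v • θ♯`. Its
first term commutes with `a`, and the other two yield operators on which
`[A (a u), a] = a [A u, a]` because `a` is skew. -/
theorem IsLeviCivitaSymbol.inducedSymbol_apply_complex (hβ : IsMetricForm β) {θ : E →L[ℝ] ℝ}
    {A : E →L[ℝ] E →L[ℝ] E} (hA : IsLeviCivitaSymbol β ((2 • θ).smulRight β) A) {a : E →L[ℝ] E}
    (ha : IsIsometricComplex β a) (u : E) :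
    inducedSymbol A a (a u) = a * inducedSymbol A a u := by
  have koszul : ∀ u v w, β (A u v) w = θ u * β v w + θ v * β u w - θ w * β u v := by
    intro u v w
    rw [hA.koszul hβ.symm]
    simp only [ContinuousLinearMap.smulRight_apply, smul_apply, smul_eq_mul, nsmul_eq_mul]
    push_cast
    ring
  have skew (v w : E) : β (a v) w = -β v (a w) := eq_neg_of_add_eq_zero_left (ha.mem_skewEnd v w)
  ext v
  refine hβ.ext fun w => ?_
  simp only [inducedSymbol_apply, mul_apply_eq_comp, map_sub, sub_apply, skew, koszul,
    ha.apply_apply, map_neg, neg_apply]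
  ring

theorem modelComplexStructure_eq_of_conformal (hβ : IsMetricForm β)
    (hΓ : IsLeviCivitaSymbol β β' Γ) {r : ℝ} (hr : r ≠ 0) {θ : E →L[ℝ] ℝ}
    (hΓ' : IsLeviCivitaSymbol (r • β) (r • ((2 • θ).smulRight β + β')) Γ')
    {a : E →L[ℝ] E} (ha : IsIsometricComplex β a) :
    modelComplexStructure Γ a = modelComplexStructure Γ' a := by
  have hsub : inducedSymbol Γ' a = inducedSymbol Γ a + inducedSymbol (Γ' - Γ) a := by
    rw [inducedSymbol, inducedSymbol, inducedSymbol, ← ContinuousLinearMap.comp_add,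
      add_sub_cancel]
  refine ContinuousLinearMap.ext fun w => ?_
  simp only [modelComplexStructure_apply, verticalPart_apply, hsub, add_apply,
    (hΓ.sub_of_conformal hr hΓ').inducedSymbol_apply_complex hβ ha, mul_add]
  congr 1
  abel

variable [FiniteDimensional ℝ E]

theorem IsMetricForm.isInvertible (hβ : IsMetricForm β) : β.IsInvertible := by
  have hinj : Function.Injective β.toLinearMap := fun v v' h => hβ.ext fun w =>
    congrArg (fun f : E →L[ℝ] ℝ => f w) h
  have hrank : Module.finrank ℝ E = Module.finrank ℝ (E →L[ℝ] ℝ) := by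
    rw [← (LinearMap.toContinuousLinearMap (𝕜 := ℝ) (E := E) (F' := ℝ)).finrank_eq]
    exact Subspace.dual_finrank_eq.symm
  exact ⟨(LinearEquiv.ofInjectiveOfFinrankEq _ hinj hrank).toContinuousLinearEquiv, rfl⟩

/-- The Christoffel symbol, given by the Koszul formula, of a metric on a vector space with value
`β` and derivative `β'` at a point. -/
def christoffel (β : E →L[ℝ] E →L[ℝ] ℝ) (β' : E →L[ℝ] E →L[ℝ] E →L[ℝ] ℝ) : E →L[ℝ] E →L[ℝ] E :=
  (LinearMap.mk₂ ℝ (fun u v => β.inverse ((1 / 2 : ℝ) • (β' u v + β' v u - (β'.flip u).flip v)))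
    (fun u u' v => by rw [← map_add]; congr 1; ext; simp; ring)
    (fun c u v => by rw [← map_smul]; congr 1; ext; simp; ring)
    (fun u v v' => by rw [← map_add]; congr 1; ext; simp; ring)
    (fun c u v => by rw [← map_smul]; congr 1; ext; simp; ring)).toContinuousBilinearMap

theorem christoffel_apply (β : E →L[ℝ] E →L[ℝ] ℝ) (β' : E →L[ℝ] E →L[ℝ] E →L[ℝ] ℝ) (u v : E) :
    christoffel β β' u v =
      β.inverse ((1 / 2 : ℝ) • (β' u v + β' v u - (β'.flip u).flip v)) := rfl

theorem IsMetricForm.apply_christoffel (hβ : IsMetricForm β) (u v w : E) :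
    β (christoffel β β' u v) w = (β' u v w + β' v u w - β' w u v) / 2 := by
  rw [christoffel_apply, hβ.isInvertible.self_apply_inverse]
  simp only [smul_apply, sub_apply, add_apply, ContinuousLinearMap.flip_apply, smul_eq_mul]
  ring

theorem IsMetricForm.isLeviCivitaSymbol_christoffel (hβ : IsMetricForm β)
    (hβ' : ∀ u v w, β' u v w = β' u w v) : IsLeviCivitaSymbol β β' (christoffel β β') where
  symm u v := hβ.ext fun w => by
    rw [hβ.apply_christoffel, hβ.apply_christoffel, hβ' w u v]
    ring
  metric u v w := by
    rw [hβ.symm v, hβ.apply_christoffel, hβ.apply_christoffel, hβ' v u w, hβ' w u v, hβ' u w v]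
    ring

theorem IsLeviCivitaSymbol.eq_christoffel (hΓ : IsLeviCivitaSymbol β β' Γ)
    (hβ : IsMetricForm β) : Γ = christoffel β β' := by
  ext u v
  refine hβ.ext fun w => ?_
  rw [hβ.apply_christoffel, hΓ.koszul hβ.symm]

theorem contDiffOn_christoffel {U : Set E} (hU : IsOpen U) {β : E → E →L[ℝ] E →L[ℝ] ℝ}
    (hβ : ∀ y ∈ U, IsMetricForm (β y)) (hs : ContDiffOn ℝ ∞ β U) :
    ContDiffOn ℝ ∞ (fun y => christoffel (β y) (fderiv ℝ β y)) U := by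
  have hinv : ContDiffOn ℝ ∞ (fun y => (β y).inverse) U := fun y hy =>
    (hβ y hy).isInvertible.contDiffAt_map_inverse.comp_contDiffWithinAt y (hs y hy)
  have hd (u v w : E) : ContDiffOn ℝ ∞ (fun y => fderiv ℝ β y u v w) U :=
    (((hs.fderiv_of_isOpen hU (by simp)).clm_apply contDiffOn_const).clm_apply
      contDiffOn_const).clm_apply contDiffOn_const
  refine contDiffOn_clm_apply.2 fun u => contDiffOn_clm_apply.2 fun v => ?_
  simp only [christoffel_apply]
  refine hinv.clm_apply (contDiffOn_clm_apply.2 fun w => ?_)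
  exact contDiffOn_const.mul (((hd u v w).add (hd v u w)).sub (hd w u v))

end Christoffel

/-! ### Isometric frames -/

section SquareChart

variable (A : Type*) [NormedRing A] [NormedAlgebra ℝ A]

theorem contDiffAt_mul_self_one : ContDiffAt ℝ ω (fun x : A => x * x) 1 :=
  contDiffAt_id.mul contDiffAt_id

theorem hasFDerivAt_mul_self_one :
    HasFDerivAt (fun x : A => x * x)
      ((ContinuousLinearEquiv.smulLeft (Units.mk0 (2 : ℝ) two_ne_zero) : A ≃L[ℝ] A) : A →L[ℝ] A)
      1 := by
  refine ((hasFDerivAt_id (𝕜 := ℝ) (1 : A)).mul' (hasFDerivAt_id _)).congr_fderiv ?_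
  ext1 x
  change 1 * x + x * 1 = (2 : ℝ) • x
  rw [one_mul, mul_one, two_smul]

variable [CompleteSpace A]

/-- The squaring map of a Banach algebra as a local homeomorphism around `1`; its inverse is a
square root. -/
def squareChart : OpenPartialHomeomorph A A :=
  (contDiffAt_mul_self_one A).toOpenPartialHomeomorph _ (hasFDerivAt_mul_self_one A) (by simp)

variable {A}

theorem squareChart_apply (x : A) : squareChart A x = x * x := rfl

theorem one_mem_squareChart_source : (1 : A) ∈ (squareChart A).source :=
  (contDiffAt_mul_self_one A).mem_toOpenPartialHomeomorph_source (hasFDerivAt_mul_self_one A)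
    (by simp)

theorem one_mem_squareChart_target : (1 : A) ∈ (squareChart A).target := by
  simpa [squareChart_apply] using (squareChart A).map_source one_mem_squareChart_source

theorem squareChart_symm_one : (squareChart A).symm 1 = 1 := by
  simpa [squareChart_apply] using (squareChart A).left_inv one_mem_squareChart_source

theorem contDiffAt_squareChart_symm : ContDiffAt ℝ ω (squareChart A).symm 1 := by
  simpa using! (contDiffAt_mul_self_one A).to_localInverse (hasFDerivAt_mul_self_one A) (by simp)

end SquareChart

section Frame

variable {E : Type*} [NormedAddCommGroup E] [NormedSpace ℝ E]

/-- The adjoint of an endomorphism for a nondegenerate bilinear form. -/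
def formAdjoint (β : E →L[ℝ] E →L[ℝ] ℝ) (x : E →L[ℝ] E) : E →L[ℝ] E :=
  β.inverse ∘L ((ContinuousLinearMap.compL ℝ E E ℝ).flip x ∘L β)

/-- A smooth frame around `y₀` in which the field `β` of bilinear forms is constant, with the
inverse operators `coframe`. -/
structure IsometricFrame (β : E → E →L[ℝ] E →L[ℝ] ℝ) (y₀ : E) where
  /-- The open set on which the frame is defined. -/
  domain : Set E
  /-- The frame at a point, as an operator from the model space to the tangent space. -/
  frame : E → E →L[ℝ] E
  /-- The inverse of the frame. -/
  coframe : E → E →L[ℝ] E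
  isOpen_domain : IsOpen domain
  mem_domain : y₀ ∈ domain
  contDiffOn_frame : ContDiffOn ℝ ∞ frame domain
  contDiffOn_coframe : ContDiffOn ℝ ∞ coframe domain
  frame_self : frame y₀ = 1
  frame_mul_coframe : ∀ y ∈ domain, frame y * coframe y = 1
  coframe_mul_frame : ∀ y ∈ domain, coframe y * frame y = 1
  isometric : ∀ y ∈ domain, ∀ v w, β y (frame y v) (frame y w) = β y₀ v w

variable {β : E →L[ℝ] E →L[ℝ] ℝ}

theorem continuous_formAdjoint : Continuous (formAdjoint β) := by
  unfold formAdjoint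
  fun_prop

variable [FiniteDimensional ℝ E]

theorem IsMetricForm.apply_formAdjoint (hβ : IsMetricForm β) (x : E →L[ℝ] E) (v w : E) :
    β (formAdjoint β x v) w = β v (x w) := by
  change β (β.inverse ((ContinuousLinearMap.compL ℝ E E ℝ).flip x (β v))) w = _
  rw [hβ.isInvertible.self_apply_inverse]
  rfl

theorem IsMetricForm.formAdjoint_eq_iff (hβ : IsMetricForm β) {x y : E →L[ℝ] E} :
    formAdjoint β x = y ↔ ∀ v w, β (y v) w = β v (x w) := by
  refine ⟨fun h v w => h ▸ hβ.apply_formAdjoint x v w, fun h => ?_⟩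
  ext v
  exact hβ.ext fun w => by rw [hβ.apply_formAdjoint, h]

theorem IsMetricForm.formAdjoint_one (hβ : IsMetricForm β) : formAdjoint β 1 = 1 :=
  hβ.formAdjoint_eq_iff.2 fun _ _ => rfl

theorem IsMetricForm.formAdjoint_mul (hβ : IsMetricForm β) (x y : E →L[ℝ] E) :
    formAdjoint β (x * y) = formAdjoint β y * formAdjoint β x :=
  hβ.formAdjoint_eq_iff.2 fun v w => by
    simp only [mul_apply_eq_comp, hβ.apply_formAdjoint]

theorem IsMetricForm.eventually_formAdjoint_squareChart_symm (hβ : IsMetricForm β) :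
    ∀ᶠ x in 𝓝 (1 : E →L[ℝ] E), formAdjoint β x = x →
      formAdjoint β ((squareChart _).symm x) = (squareChart _).symm x := by
  have hadjoint : ∀ᶠ x in 𝓝 1,
      formAdjoint β ((squareChart _).symm x) ∈ (squareChart (E →L[ℝ] E)).source := by
    refine (continuous_formAdjoint.continuousAt.comp
      contDiffAt_squareChart_symm.continuousAt).eventually ((squareChart _).open_source.mem_nhds ?_)
    rw [Function.comp_apply, squareChart_symm_one, hβ.formAdjoint_one]
    exact one_mem_squareChart_source
  filter_upwards [hadjoint, (squareChart _).open_target.mem_nhds one_mem_squareChart_target]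
    with x hs hx hself
  refine (squareChart _).injOn hs ((squareChart _).map_target hx) ?_
  have hsq := (squareChart _).right_inv hx
  rw [hsq, squareChart_apply, ← hβ.formAdjoint_mul, ← squareChart_apply, hsq, hself]

theorem IsMetricForm.eventually_isometric_squareChart_symm (hβ : IsMetricForm β) :
    ∀ᶠ x in 𝓝 (1 : E →L[ℝ] E), (∀ v w, β (x v) w = β v (x w)) →
      ∀ v w, β ((squareChart (E →L[ℝ] E)).symm x v) ((squareChart (E →L[ℝ] E)).symm x w) =
        β (x v) w := by
  filter_upwards [hβ.eventually_formAdjoint_squareChart_symm,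
    (squareChart _).open_target.mem_nhds one_mem_squareChart_target] with x hadjoint hx hself v w
  have hsymm := hβ.formAdjoint_eq_iff.1 (hadjoint (hβ.formAdjoint_eq_iff.2 hself))
  have hsq : (squareChart _).symm x * (squareChart _).symm x = x := (squareChart _).right_inv hx
  rw [← hsymm, ← mul_apply_eq_comp, hsq]

/-- The square root of the operator that represents `β y` in terms of `β y₀` is the coframe. -/
theorem exists_isometricFrame {U : Set E} (hU : IsOpen U) {β : E → E →L[ℝ] E →L[ℝ] ℝ}
    (hβ : ∀ y ∈ U, IsMetricForm (β y)) (hs : ContDiffOn ℝ ∞ β U) {y₀ : E} (hy₀ : y₀ ∈ U) :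
    ∃ F : IsometricFrame β y₀, F.domain ⊆ U := by
  have hβ₀ := hβ y₀ hy₀
  let G (y : E) : E →L[ℝ] E := (β y₀).inverse ∘L β y
  have hG (y v w : E) : β y₀ (G y v) w = β y v w :=
    congrArg (fun f => f w) (hβ₀.isInvertible.self_apply_inverse (β y v))
  have hG₀ : G y₀ = 1 := hβ₀.isInvertible.inverse_comp_self
  have hGs : ContDiffOn ℝ ∞ G U := contDiffOn_const.clm_comp hs
  have hGt : Tendsto G (𝓝 y₀) (𝓝 1) := hG₀ ▸ hGs.continuousOn.continuousAt (hU.mem_nhds hy₀)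
  let S (y : E) : E →L[ℝ] E := (squareChart _).symm (G y)
  have hS₀ : S y₀ = 1 := by simp only [S, hG₀, squareChart_symm_one]
  have hsmooth : ∀ᶠ y in 𝓝 y₀, ContDiffAt ℝ ∞ S y := by
    filter_upwards [hU.mem_nhds hy₀,
      hGt.eventually (contDiffAt_squareChart_symm.eventually (by simp))] with y hyU hy
    exact (hy.of_le (by simp)).comp y (hGs.contDiffAt (hU.mem_nhds hyU))
  have hunit : ∀ᶠ y in 𝓝 y₀, IsUnit (S y) :=
    hsmooth.self_of_nhds.continuousAt.eventually (Units.isOpen.mem_nhds (hS₀ ▸ isUnit_one))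
  obtain ⟨V, hV, hVo, hyV⟩ := eventually_nhds_iff.1 (hsmooth.and (hunit.and
    ((hGt.eventually hβ₀.eventually_isometric_squareChart_symm).and (hU.mem_nhds hy₀))))
  refine ⟨⟨V, fun y => Ring.inverse (S y), S, hVo, hyV, fun y hy => ?_,
    fun y hy => (hV y hy).1.contDiffWithinAt, by simp only [hS₀, Ring.inverse_one],
    fun y hy => Ring.inverse_mul_cancel _ (hV y hy).2.1,
    fun y hy => Ring.mul_inverse_cancel _ (hV y hy).2.1, fun y hy v w => ?_⟩,
    fun y hy => (hV y hy).2.2.2⟩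
  · obtain ⟨hSy, ⟨s, hs⟩, -⟩ := hV y hy
    exact ((hs ▸ contDiffAt_ringInverse ℝ s).comp y hSy).contDiffWithinAt
  · obtain ⟨-, hunit, hisometric, hyU⟩ := hV y hy
    have hcancel (v : E) : S y (Ring.inverse (S y) v) = v :=
      congrArg (fun f => f v) (Ring.mul_inverse_cancel _ hunit)
    have hself (v w : E) : β y₀ (G y v) w = β y₀ v (G y w) := by
      rw [hβ₀.symm v, hG, hG, (hβ y hyU).symm]
    rw [← hG, ← hisometric hself, hcancel, hcancel]

end Frame

/-! ### The Cayley transform and the flattening of the set of isometric complex structures -/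

section Cayley

variable {A : Type*} [NormedRing A] [NormedAlgebra ℝ A]

/-- The Cayley transform `c ↦ (1 - c) (1 + c)⁻¹`, an involution. It is undefined where `1 + c` is
not invertible; `Ring.inverse` is `0` there. -/
def cayley (c : A) : A := (2 : ℝ) • Ring.inverse (1 + c) - 1

theorem one_add_cayley (c : A) : 1 + cayley c = (2 : ℝ) • Ring.inverse (1 + c) :=
  add_sub_cancel _ _

theorem one_add_cayley_mul {c : A} (hc : IsUnit (1 + c)) :
    (1 + cayley c) * ((1 / 2 : ℝ) • (1 + c)) = 1 := by
  rw [one_add_cayley, smul_mul_smul_comm, Ring.inverse_mul_cancel _ hc]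
  norm_num

theorem mul_one_add_cayley {c : A} (hc : IsUnit (1 + c)) :
    ((1 / 2 : ℝ) • (1 + c)) * (1 + cayley c) = 1 := by
  rw [one_add_cayley, smul_mul_smul_comm, Ring.mul_inverse_cancel _ hc]
  norm_num

theorem isUnit_one_add_cayley {c : A} (hc : IsUnit (1 + c)) : IsUnit (1 + cayley c) :=
  ⟨⟨_, _, one_add_cayley_mul hc, mul_one_add_cayley hc⟩, rfl⟩

theorem cayley_cayley {c : A} (hc : IsUnit (1 + c)) : cayley (cayley c) = c := by
  rw [cayley, Ring.inverse_unit ⟨_, _, one_add_cayley_mul hc, mul_one_add_cayley hc⟩]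
  simp

theorem cayley_mul_one_add {c : A} (hc : IsUnit (1 + c)) : cayley c * (1 + c) = 1 - c := by
  rw [cayley, sub_mul, smul_mul_assoc, Ring.inverse_mul_cancel _ hc, two_smul]
  noncomm_ring

theorem one_add_mul_cayley {c : A} (hc : IsUnit (1 + c)) : (1 + c) * cayley c = 1 - c := by
  rw [cayley, mul_sub, mul_smul_comm, Ring.mul_inverse_cancel _ hc, two_smul]
  noncomm_ring

theorem cayley_mem_anticommutant_iff {a c : A} (hc : IsUnit (1 + c)) :
    cayley c ∈ anticommutant ℝ a ↔ c * a * c = a := by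
  have key : (1 + c) * (a * cayley c + cayley c * a) * (1 + c) = (2 : ℝ) • (a - c * a * c) := by
    calc _ = (1 + c) * a * (cayley c * (1 + c)) + (1 + c) * cayley c * a * (1 + c) := by
          noncomm_ring
      _ = (1 + c) * a * (1 - c) + (1 - c) * a * (1 + c) := by
          rw [cayley_mul_one_add hc, one_add_mul_cayley hc]
      _ = (2 : ℝ) • (a - c * a * c) := by rw [two_smul]; noncomm_ring
  rw [mem_anticommutant, ← hc.mul_right_eq_zero, ← hc.mul_left_eq_zero, key,
    smul_eq_zero_iff_right two_ne_zero, sub_eq_zero, eq_comm]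

theorem contDiffOn_cayley [CompleteSpace A] {n : WithTop ℕ∞} :
    ContDiffOn ℝ n (cayley : A → A) {c | IsUnit (1 + c)} := by
  rintro c ⟨u, hu⟩
  have hinv : ContDiffAt ℝ n Ring.inverse (1 + c) := hu ▸ contDiffAt_ringInverse ℝ u
  exact (((hinv.comp c (contDiffAt_const.add contDiffAt_id)).const_smul (2 : ℝ)).sub
    contDiffAt_const).contDiffWithinAt

variable (A) in
/-- The Cayley transform as a local homeomorphism. -/
def cayleyChart [CompleteSpace A] : OpenPartialHomeomorph A A where
  toFun := cayley
  invFun := cayley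
  source := {c | IsUnit (1 + c)}
  target := {c | IsUnit (1 + c)}
  map_source' _ := isUnit_one_add_cayley
  map_target' _ := isUnit_one_add_cayley
  left_inv' _ := cayley_cayley
  right_inv' _ := cayley_cayley
  open_source := Units.isOpen.preimage (continuous_const_add 1)
  open_target := Units.isOpen.preimage (continuous_const_add 1)
  continuousOn_toFun := (contDiffOn_cayley (n := 0)).continuousOn
  continuousOn_invFun := (contDiffOn_cayley (n := 0)).continuousOn

theorem contDiffOn_prodMap_cayley [CompleteSpace A] {X : Type*} [NormedAddCommGroup X]
    [NormedSpace ℝ X] : ContDiffOn ℝ ∞ (Prod.map id cayley : X × A → X × A)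
    (Set.univ ×ˢ {c | IsUnit (1 + c)}) :=
  contDiffOn_id.prodMap contDiffOn_cayley

end Cayley

section Flattening

variable {E : Type*} [NormedAddCommGroup E] [NormedSpace ℝ E]

theorem cayley_mem_skewEnd_iff {β : E →L[ℝ] E →L[ℝ] ℝ} {c : E →L[ℝ] E} (hc : IsUnit (1 + c)) :
    cayley c ∈ skewEnd β ↔ ∀ v w, β (c v) (c w) = β v w := by
  have hcayley (v : E) : cayley c ((1 + c) v) = (1 - c) v :=
    congrArg (fun f => f v) (cayley_mul_one_add hc)
  have key (v w : E) : β (cayley c ((1 + c) v)) ((1 + c) w) + β ((1 + c) v) (cayley c ((1 + c) w)) =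
      2 * (β v w - β (c v) (c w)) := by
    rw [hcayley, hcayley]
    simp only [add_apply, sub_apply, one_apply_eq_self, map_add, map_sub]
    ring
  have hsurj (v : E) : ∃ v', (1 + c) v' = v :=
    ⟨Ring.inverse (1 + c) v, congrArg (fun f => f v) (Ring.mul_inverse_cancel _ hc)⟩
  constructor
  · intro h v w
    linear_combination (h ((1 + c) v) ((1 + c) w) - key v w) / -2
  · intro h v w
    obtain ⟨v, rfl⟩ := hsurj v
    obtain ⟨w, rfl⟩ := hsurj w
    rw [key, h, sub_self, mul_zero]

theorem IsIsometricComplex.cayley_mem_iff {β : E →L[ℝ] E →L[ℝ] ℝ} {a₀ a : E →L[ℝ] E}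
    (ha₀ : IsIsometricComplex β a₀) (hu : IsUnit (1 + -(a₀ * a))) :
    cayley (-(a₀ * a)) ∈ anticommutant ℝ a₀ ⊓ skewEnd β ↔ IsIsometricComplex β a := by
  have hsq : -(a₀ * a) * a₀ * -(a₀ * a) = a₀ ↔ a * a = -1 := by
    have : -(a₀ * a) * a₀ * -(a₀ * a) = a₀ * (a * (a₀ * a₀) * a) := by noncomm_ring
    rw [this, ha₀.sq_eq]
    constructor
    · intro h
      calc a * a = a₀ * a₀ * (a * -1 * a) := by rw [ha₀.sq_eq]; noncomm_ring
        _ = -1 := by rw [mul_assoc, h, ha₀.sq_eq]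
    · intro h
      calc a₀ * (a * -1 * a) = -(a₀ * (a * a)) := by noncomm_ring
        _ = a₀ := by rw [h]; noncomm_ring
  have hisometric : (∀ v w, β ((-(a₀ * a)) v) ((-(a₀ * a)) w) = β v w) ↔
      ∀ v w, β (a v) (a w) = β v w := by
    simp only [neg_apply, map_neg, neg_neg, mul_apply_eq_comp, ha₀.isometric]
  rw [Submodule.mem_inf, cayley_mem_anticommutant_iff hu, cayley_mem_skewEnd_iff hu, hsq,
    hisometric]
  exact ⟨fun h => ⟨h.1, h.2⟩, fun h => ⟨h.1, h.2⟩⟩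

namespace IsometricFrame

variable {β : E → E →L[ℝ] E →L[ℝ] ℝ} {y₀ : E} (F : IsometricFrame β y₀) {a₀ : E →L[ℝ] E}

theorem contDiffOn_frame_fst :
    ContDiffOn ℝ ∞ (fun w : E × (E →L[ℝ] E) => F.frame w.1) (F.domain ×ˢ Set.univ) :=
  F.contDiffOn_frame.comp contDiff_fst.contDiffOn fun _ hw => hw.1

theorem contDiffOn_coframe_fst :
    ContDiffOn ℝ ∞ (fun w : E × (E →L[ℝ] E) => F.coframe w.1) (F.domain ×ˢ Set.univ) :=
  F.contDiffOn_coframe.comp contDiff_fst.contDiffOn fun _ hw => hw.1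

theorem contDiffOn_conj : ContDiffOn ℝ ∞
    (fun w : E × (E →L[ℝ] E) => (w.1, -(a₀ * (F.coframe w.1 * w.2 * F.frame w.1))))
    (F.domain ×ˢ Set.univ) :=
  contDiffOn_fst.prodMk (contDiffOn_const.mul
    ((F.contDiffOn_coframe_fst.mul contDiffOn_snd).mul F.contDiffOn_frame_fst)).neg

theorem contDiffOn_conj_symm : ContDiffOn ℝ ∞
    (fun w : E × (E →L[ℝ] E) => (w.1, F.frame w.1 * (a₀ * w.2) * F.coframe w.1))
    (F.domain ×ˢ Set.univ) :=
  contDiffOn_fst.prodMk ((F.contDiffOn_frame_fst.mul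
    (contDiffOn_const.mul contDiffOn_snd)).mul F.contDiffOn_coframe_fst)

variable [CompleteSpace E]

/-- The local homeomorphism that expresses the endomorphism `w.2` at the point `w.1` in an isometric
frame and multiplies it by `-a₀ = a₀⁻¹`. -/
def conjChart (ha₀ : a₀ * a₀ = -1) : OpenPartialHomeomorph (E × (E →L[ℝ] E)) (E × (E →L[ℝ] E)) where
  toFun w := (w.1, -(a₀ * (F.coframe w.1 * w.2 * F.frame w.1)))
  invFun w := (w.1, F.frame w.1 * (a₀ * w.2) * F.coframe w.1)
  source := F.domain ×ˢ Set.univ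
  target := F.domain ×ˢ Set.univ
  map_source' _ hw := ⟨hw.1, trivial⟩
  map_target' _ hw := ⟨hw.1, trivial⟩
  left_inv' w hw := Prod.ext rfl <| by
    set p := F.frame w.1
    set q := F.coframe w.1
    calc p * (a₀ * -(a₀ * (q * w.2 * p))) * q
        = -(p * (a₀ * a₀) * q * w.2 * (p * q)) := by noncomm_ring
      _ = p * q * w.2 * (p * q) := by rw [ha₀]; noncomm_ring
      _ = w.2 := by rw [F.frame_mul_coframe _ hw.1, one_mul, mul_one]
  right_inv' w hw := Prod.ext rfl <| by
    set p := F.frame w.1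
    set q := F.coframe w.1
    calc -(a₀ * (q * (p * (a₀ * w.2) * q) * p))
        = -(a₀ * ((q * p) * (a₀ * w.2) * (q * p))) := by noncomm_ring
      _ = -(a₀ * a₀ * w.2) := by
          rw [F.coframe_mul_frame _ hw.1, one_mul, mul_one, mul_assoc]
      _ = w.2 := by rw [ha₀]; noncomm_ring
  open_source := F.isOpen_domain.prod isOpen_univ
  open_target := F.isOpen_domain.prod isOpen_univ
  continuousOn_toFun := F.contDiffOn_conj.continuousOn
  continuousOn_invFun := F.contDiffOn_conj_symm.continuousOn

/-- A local diffeomorphism of `E × End E` that maps the set of isometric complex structures to a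
vector subspace: the Cayley transform in an isometric frame. -/
def flattening (ha₀ : a₀ * a₀ = -1) :
    OpenPartialHomeomorph (E × (E →L[ℝ] E)) (E × (E →L[ℝ] E)) :=
  (F.conjChart ha₀).trans ((OpenPartialHomeomorph.refl E).prod (cayleyChart (E →L[ℝ] E)))

variable (ha₀ : a₀ * a₀ = -1)

theorem flattening_source : (F.flattening ha₀).source =
    {w | w.1 ∈ F.domain ∧ IsUnit (1 + -(a₀ * (F.coframe w.1 * w.2 * F.frame w.1)))} := by
  ext w
  simp [flattening, conjChart, cayleyChart]

theorem flattening_apply (w : E × (E →L[ℝ] E)) : F.flattening ha₀ w =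
    (w.1, cayley (-(a₀ * (F.coframe w.1 * w.2 * F.frame w.1)))) := rfl

theorem mem_flattening_source : (y₀, a₀) ∈ (F.flattening ha₀).source := by
  have hcoframe : F.coframe y₀ = 1 := by
    simpa [F.frame_self] using F.frame_mul_coframe y₀ F.mem_domain
  rw [flattening_source]
  refine ⟨F.mem_domain, ?_⟩
  have h2 : (1 : E →L[ℝ] E) + -(a₀ * (F.coframe y₀ * a₀ * F.frame y₀)) = algebraMap ℝ _ 2 := by
    rw [hcoframe, F.frame_self, one_mul, mul_one, ha₀, neg_neg, one_add_one_eq_two, map_ofNat]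
  rw [h2]
  exact (isUnit_iff_ne_zero.2 two_ne_zero).map _

theorem contDiffOn_flattening :
    ContDiffOn ℝ ∞ (F.flattening ha₀) (F.flattening ha₀).source :=
  contDiffOn_prodMap_cayley.comp (F.contDiffOn_conj.mono fun _ hw => hw.1) fun _ hw => hw.2

theorem contDiffOn_flattening_symm :
    ContDiffOn ℝ ∞ (F.flattening ha₀).symm (F.flattening ha₀).target :=
  F.contDiffOn_conj_symm.comp (contDiffOn_prodMap_cayley.mono fun _ hw => hw.1) fun _ hw => hw.2

theorem flattening_mem_iff (ha₀ : IsIsometricComplex (β y₀) a₀) {w : E × (E →L[ℝ] E)}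
    (hw : w ∈ (F.flattening ha₀.sq_eq).source) :
    F.flattening ha₀.sq_eq w ∈ (⊤ : Submodule ℝ E).prod (anticommutant ℝ a₀ ⊓ skewEnd (β y₀)) ↔
      IsIsometricComplex (β w.1) w.2 := by
  rw [flattening_source] at hw
  rw [flattening_apply, Submodule.mem_prod, ha₀.cayley_mem_iff hw.2,
    isIsometricComplex_conj_iff (F.frame_mul_coframe _ hw.1) (F.coframe_mul_frame _ hw.1)
      (F.isometric _ hw.1)]
  exact and_iff_right trivial

end IsometricFrame

end Flattening

/-! ### Tangent vectors and linear connections in coordinates -/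

section TangentCoord

variable {W : Type*} [NormedAddCommGroup W] [NormedSpace ℝ W]
  {HN : Type*} [TopologicalSpace HN] (I : ModelWithCorners ℝ W HN)
  {N : Type*} [TopologicalSpace N] [ChartedSpace HN N] {x₀ x : N}

theorem extChartAt_left_inv (hx : x ∈ (chartAt HN x₀).source) :
    (extChartAt I x₀).symm (extChartAt I x₀ x) = x :=
  (extChartAt I x₀).left_inv ((extChartAt_source I x₀).symm ▸ hx)

theorem extChartAt_mem_target (hx : x ∈ (chartAt HN x₀).source) :
    extChartAt I x₀ x ∈ (extChartAt I x₀).target :=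
  (extChartAt I x₀).map_source ((extChartAt_source I x₀).symm ▸ hx)

theorem extChartAt_symm_mem_source {y : W} (hy : y ∈ (extChartAt I x₀).target) :
    (extChartAt I x₀).symm y ∈ (chartAt HN x₀).source :=
  extChartAt_source I x₀ ▸ (extChartAt I x₀).map_target hy

variable [IsManifold I 1 N]

/-- The coordinate expression, in the preferred chart at `x₀`, of the tangent vectors at `x`. -/
def tangentCoord (x₀ x : N) : TangentSpace I x →L[ℝ] W :=
  (trivializationAt W (TangentSpace I) x₀).continuousLinearMapAt ℝ x

/-- The tangent vector at `x` with a given coordinate expression in the preferred chart at `x₀`. -/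
def tangentCoordSymm (x₀ x : N) : W →L[ℝ] TangentSpace I x :=
  (trivializationAt W (TangentSpace I) x₀).symmL ℝ x

variable {I}

theorem tangentCoord_tangentCoordSymm (hx : x ∈ (chartAt HN x₀).source) (v : W) :
    tangentCoord I x₀ x (tangentCoordSymm I x₀ x v) = v :=
  (trivializationAt W (TangentSpace I) x₀).continuousLinearMapAt_symmL hx v

theorem tangentCoordSymm_tangentCoord (hx : x ∈ (chartAt HN x₀).source) (v : TangentSpace I x) :
    tangentCoordSymm I x₀ x (tangentCoord I x₀ x v) = v :=
  (trivializationAt W (TangentSpace I) x₀).symmL_continuousLinearMapAt hx v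

theorem tangentCoord_injective (hx : x ∈ (chartAt HN x₀).source) :
    Function.Injective (tangentCoord I x₀ x) :=
  Function.LeftInverse.injective (tangentCoordSymm_tangentCoord hx)

theorem hasMFDerivAt_extChartAt (hx : x ∈ (chartAt HN x₀).source) :
    HasMFDerivAt I 𝓘(ℝ, W) (extChartAt I x₀) x (tangentCoord I x₀ x) := by
  have h := (mdifferentiableAt_extChartAt (I := I) hx).hasMFDerivAt
  rwa [← TangentBundle.continuousLinearMapAt_trivializationAt (I := I) hx] at h

theorem hasDerivAt_extChartAt_comp {γ : ℝ → N} {t : ℝ}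
    (hγ : MDifferentiableAt 𝓘(ℝ, ℝ) I γ t) (ht : γ t ∈ (chartAt HN x₀).source) :
    HasDerivAt (fun s => extChartAt I x₀ (γ s))
      (tangentCoord I x₀ (γ t) (mfderiv 𝓘(ℝ, ℝ) I γ t (1 : ℝ))) t := by
  let L : ℝ →L[ℝ] W := tangentCoord I x₀ (γ t) ∘L mfderiv 𝓘(ℝ, ℝ) I γ t
  have h : HasMFDerivAt 𝓘(ℝ, ℝ) 𝓘(ℝ, W) (fun s => extChartAt I x₀ (γ s)) t L :=
    (hasMFDerivAt_extChartAt ht).comp t hγ.hasMFDerivAt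
  have h' : HasFDerivAt (fun s => extChartAt I x₀ (γ s)) L t := h.hasFDerivAt
  exact h'.hasDerivAt

section Boundaryless

variable [I.Boundaryless] {F : Type*} [NormedAddCommGroup F] [NormedSpace ℝ F] {f : N → F}

theorem differentiableAt_comp_extChartAt_symm
    (hx : x ∈ (chartAt HN x₀).source) (hf : MDifferentiableAt I 𝓘(ℝ, F) f x) :
    DifferentiableAt ℝ (f ∘ (extChartAt I x₀).symm) (extChartAt I x₀ x) := by
  have hsymm := mdifferentiableWithinAt_extChartAt_symm (I := I) (extChartAt_mem_target I hx)
  rw [I.range_eq_univ, mdifferentiableWithinAt_univ] at hsymm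
  rw [← mdifferentiableAt_iff_differentiableAt]
  exact MDifferentiableAt.comp _ (by rwa [extChartAt_left_inv I hx]) hsymm

theorem hasMFDerivAt_fderiv_comp_tangentCoord
    (hx : x ∈ (chartAt HN x₀).source) (hf : MDifferentiableAt I 𝓘(ℝ, F) f x) :
    HasMFDerivAt I 𝓘(ℝ, F) f x
      (fderiv ℝ (f ∘ (extChartAt I x₀).symm) (extChartAt I x₀ x) ∘L tangentCoord I x₀ x) := by
  have h := (differentiableAt_comp_extChartAt_symm hx hf).hasFDerivAt.hasMFDerivAt.comp x
    (hasMFDerivAt_extChartAt hx)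
  refine h.congr_of_eventuallyEq ?_
  filter_upwards [(chartAt HN x₀).open_source.mem_nhds hx] with z hz
  rw [Function.comp_apply, Function.comp_apply, extChartAt_left_inv I hz]

end Boundaryless

end TangentCoord

section CoordField

variable {E : Type*} [NormedAddCommGroup E] [NormedSpace ℝ E]
  {M : Type*} [TopologicalSpace M] [ChartedSpace E M] [IsManifold 𝓘(ℝ, E) ∞ M] {x₀ x : M}

/-- The coordinate expression of a vector field in the preferred chart at `x₀`. -/
def coordField (x₀ : M) (σ : Π x : M, TangentSpace 𝓘(ℝ, E) x) (y : E) : E :=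
  tangentCoord 𝓘(ℝ, E) x₀ ((extChartAt 𝓘(ℝ, E) x₀).symm y) (σ ((extChartAt 𝓘(ℝ, E) x₀).symm y))

theorem coordField_extChartAt (hx : x ∈ (chartAt E x₀).source)
    (σ : Π x : M, TangentSpace 𝓘(ℝ, E) x) :
    coordField x₀ σ (extChartAt 𝓘(ℝ, E) x₀ x) = tangentCoord 𝓘(ℝ, E) x₀ x (σ x) := by
  rw [coordField, extChartAt_left_inv _ hx]

theorem mdifferentiableAt_section_iff_tangentCoord (hx : x ∈ (chartAt E x₀).source)
    {σ : Π x : M, TangentSpace 𝓘(ℝ, E) x} :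
    MDifferentiableAt 𝓘(ℝ, E) (𝓘(ℝ, E).prod 𝓘(ℝ, E))
      (fun x => (⟨x, σ x⟩ : TangentBundle 𝓘(ℝ, E) M)) x ↔
    MDifferentiableAt 𝓘(ℝ, E) 𝓘(ℝ, E) (fun x => tangentCoord 𝓘(ℝ, E) x₀ x (σ x)) x := by
  rw [(trivializationAt E (TangentSpace 𝓘(ℝ, E)) x₀).mdifferentiableAt_section_iff 𝓘(ℝ, E) σ hx]
  refine Filter.EventuallyEq.mdifferentiableAt_iff ?_
  filter_upwards [(chartAt E x₀).open_source.mem_nhds hx] with z hz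
  exact ((trivializationAt E (TangentSpace 𝓘(ℝ, E)) x₀).continuousLinearMapAt_apply_of_mem ℝ hz
    (σ z)).symm

theorem differentiableAt_coordField (hx : x ∈ (chartAt E x₀).source)
    {σ : Π x : M, TangentSpace 𝓘(ℝ, E) x}
    (hσ : MDifferentiableAt 𝓘(ℝ, E) (𝓘(ℝ, E).prod 𝓘(ℝ, E))
      (fun x => (⟨x, σ x⟩ : TangentBundle 𝓘(ℝ, E) M)) x) :
    DifferentiableAt ℝ (coordField x₀ σ) (extChartAt 𝓘(ℝ, E) x₀ x) :=
  differentiableAt_comp_extChartAt_symm hx ((mdifferentiableAt_section_iff_tangentCoord hx).1 hσ)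

/-- The vector field with constant coordinate expression `v` in the preferred chart at `x₀`. -/
def constField (x₀ : M) (v : E) (x : M) : TangentSpace 𝓘(ℝ, E) x :=
  tangentCoordSymm 𝓘(ℝ, E) x₀ x v

theorem tangentCoord_constField (hx : x ∈ (chartAt E x₀).source) (v : E) :
    tangentCoord 𝓘(ℝ, E) x₀ x (constField x₀ v x) = v :=
  tangentCoord_tangentCoordSymm hx v

theorem mdifferentiableAt_constField (hx : x ∈ (chartAt E x₀).source) (v : E) :
    MDifferentiableAt 𝓘(ℝ, E) (𝓘(ℝ, E).prod 𝓘(ℝ, E))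
      (fun x => (⟨x, constField x₀ v x⟩ : TangentBundle 𝓘(ℝ, E) M)) x := by
  rw [mdifferentiableAt_section_iff_tangentCoord hx]
  refine (mdifferentiableAt_const (c := v)).congr_of_eventuallyEq ?_
  filter_upwards [(chartAt E x₀).open_source.mem_nhds hx] with z hz
  exact tangentCoord_constField hz v

theorem coordField_constField_eventuallyEq (hx : x ∈ (chartAt E x₀).source) (v : E) :
    coordField x₀ (constField x₀ v) =ᶠ[𝓝 (extChartAt 𝓘(ℝ, E) x₀ x)] fun _ => v := by
  filter_upwards [(isOpen_extChartAt_target x₀).mem_nhds (extChartAt_mem_target _ hx)] with y hy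
  exact tangentCoord_constField (extChartAt_symm_mem_source _ hy) v

end CoordField

section ConnectionSymbol

variable {E : Type*} [NormedAddCommGroup E] [NormedSpace ℝ E]
  {M : Type*} [TopologicalSpace M] [ChartedSpace E M] [IsManifold 𝓘(ℝ, E) ∞ M] {x₀ x : M}

/-- The flat connection of the preferred chart at `x₀`: it differentiates the coordinate expressions
of vector fields. It is meaningful on the domain of the chart only. -/
def flatConnection (x₀ : M) (σ : Π x : M, TangentSpace 𝓘(ℝ, E) x) (x : M) :
    TangentSpace 𝓘(ℝ, E) x →L[ℝ] TangentSpace 𝓘(ℝ, E) x :=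
  tangentCoordSymm 𝓘(ℝ, E) x₀ x ∘L fderiv ℝ (coordField x₀ σ) (extChartAt 𝓘(ℝ, E) x₀ x) ∘L
    tangentCoord 𝓘(ℝ, E) x₀ x

theorem flatConnection_apply (x₀ x : M) (σ : Π x : M, TangentSpace 𝓘(ℝ, E) x)
    (X : TangentSpace 𝓘(ℝ, E) x) :
    flatConnection x₀ σ x X = tangentCoordSymm 𝓘(ℝ, E) x₀ x
      (fderiv ℝ (coordField x₀ σ) (extChartAt 𝓘(ℝ, E) x₀ x) (tangentCoord 𝓘(ℝ, E) x₀ x X)) :=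
  rfl

theorem isCovariantDerivativeOn_flatConnection (x₀ : M) :
    IsCovariantDerivativeOn E (flatConnection (E := E) x₀) (chartAt E x₀).source where
  add {σ σ' x} hσ hσ' hx := by
    have hadd : coordField x₀ (σ + σ') = coordField x₀ σ + coordField x₀ σ' := by
      ext y
      exact map_add (tangentCoord 𝓘(ℝ, E) x₀ _) _ _
    rw [flatConnection, hadd, fderiv_add (differentiableAt_coordField hx hσ)
      (differentiableAt_coordField hx hσ')]
    ext v
    simp [flatConnection]
  leibniz {σ g x} hσ hg hx := by
    have hsmul : coordField x₀ (g • σ) =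
        fun y => (g ∘ (extChartAt 𝓘(ℝ, E) x₀).symm) y • coordField x₀ σ y := by
      ext y
      exact map_smul (tangentCoord 𝓘(ℝ, E) x₀ _) _ _
    have hdg (v : TangentSpace 𝓘(ℝ, E) x) : mvfderiv 𝓘(ℝ, E) g x v =
        fderiv ℝ (g ∘ (extChartAt 𝓘(ℝ, E) x₀).symm) (extChartAt 𝓘(ℝ, E) x₀ x)
          (tangentCoord 𝓘(ℝ, E) x₀ x v) := by
      rw [mvfderiv, (hasMFDerivAt_fderiv_comp_tangentCoord hx hg).mfderiv]
      rfl
    ext v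
    rw [flatConnection_apply, hsmul, fderiv_fun_smul (differentiableAt_comp_extChartAt_symm hx hg)
      (differentiableAt_coordField hx hσ), add_apply, smul_apply,
      ContinuousLinearMap.smulRight_apply, map_add, map_smul, map_smul, coordField_extChartAt hx,
      tangentCoordSymm_tangentCoord hx, ← hdg, Function.comp_apply, extChartAt_left_inv _ hx,
      ← flatConnection_apply]
    rfl

variable [FiniteDimensional ℝ E]

/-- The Christoffel symbol at `x` of a linear connection, in the preferred chart at `x₀`: the
difference of the connection and the flat connection of the chart. -/
def connectionSymbol (D : LinearConnection E M) (x₀ x : M) : E →L[ℝ] E →L[ℝ] E :=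
  (LinearMap.mk₂ ℝ
    (fun u v => tangentCoord 𝓘(ℝ, E) x₀ x (D.isCovariantDerivativeOn.difference
      (isCovariantDerivativeOn_flatConnection x₀) x (tangentCoordSymm 𝓘(ℝ, E) x₀ x v)
      (tangentCoordSymm 𝓘(ℝ, E) x₀ x u)))
    (fun u u' v => by simp only [map_add])
    (fun c u v => by simp only [map_smul])
    (fun u v v' => by simp only [map_add, add_apply])
    (fun c u v => by simp only [map_smul, smul_apply])).toContinuousBilinearMap

theorem connectionSymbol_apply (D : LinearConnection E M) (x₀ x : M) (u v : E) :
    connectionSymbol D x₀ x u v = tangentCoord 𝓘(ℝ, E) x₀ x (D.isCovariantDerivativeOn.difference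
      (isCovariantDerivativeOn_flatConnection x₀) x (tangentCoordSymm 𝓘(ℝ, E) x₀ x v)
      (tangentCoordSymm 𝓘(ℝ, E) x₀ x u)) :=
  rfl

theorem tangentCoord_connection (D : LinearConnection E M) (hx : x ∈ (chartAt E x₀).source)
    {σ : Π x : M, TangentSpace 𝓘(ℝ, E) x}
    (hσ : MDifferentiableAt 𝓘(ℝ, E) (𝓘(ℝ, E).prod 𝓘(ℝ, E))
      (fun x => (⟨x, σ x⟩ : TangentBundle 𝓘(ℝ, E) M)) x) (X : TangentSpace 𝓘(ℝ, E) x) :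
    tangentCoord 𝓘(ℝ, E) x₀ x (D σ x X) =
      fderiv ℝ (coordField x₀ σ) (extChartAt 𝓘(ℝ, E) x₀ x) (tangentCoord 𝓘(ℝ, E) x₀ x X) +
        connectionSymbol D x₀ x (tangentCoord 𝓘(ℝ, E) x₀ x X)
          (tangentCoord 𝓘(ℝ, E) x₀ x (σ x)) := by
  rw [connectionSymbol_apply, tangentCoordSymm_tangentCoord hx, tangentCoordSymm_tangentCoord hx,
    IsCovariantDerivativeOn.difference_apply D.isCovariantDerivativeOn
      (isCovariantDerivativeOn_flatConnection x₀) hx hσ,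
    sub_apply, map_sub, flatConnection_apply, tangentCoord_tangentCoordSymm hx, add_sub_cancel]

theorem tangentCoord_connection_constField (D : LinearConnection E M)
    (hx : x ∈ (chartAt E x₀).source) (v : E) (X : TangentSpace 𝓘(ℝ, E) x) :
    tangentCoord 𝓘(ℝ, E) x₀ x (D (constField x₀ v) x X) =
      connectionSymbol D x₀ x (tangentCoord 𝓘(ℝ, E) x₀ x X) v := by
  rw [tangentCoord_connection D hx (mdifferentiableAt_constField hx v),
    (coordField_constField_eventuallyEq hx v).fderiv_eq, fderiv_const_apply,
    tangentCoord_constField hx, zero_apply, zero_add]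

end ConnectionSymbol

section EndCoord

variable {E : Type*} [NormedAddCommGroup E] [NormedSpace ℝ E]
  {M : Type*} [TopologicalSpace M] [ChartedSpace E M] [IsManifold 𝓘(ℝ, E) ∞ M] {x₀ x : M}

/-- The coordinate expression, in the preferred chart at `x₀`, of the endomorphisms of the tangent
space at `x`. -/
def endCoord (x₀ x : M) : EndFiber E x →L[ℝ] E →L[ℝ] E :=
  ContinuousLinearMap.postcomp E (tangentCoord 𝓘(ℝ, E) x₀ x) ∘L
    ContinuousLinearMap.precomp (TangentSpace 𝓘(ℝ, E) x) (tangentCoordSymm 𝓘(ℝ, E) x₀ x)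

theorem endCoord_apply (x₀ x : M) (A : EndFiber E x) (v : E) :
    endCoord x₀ x A v = tangentCoord 𝓘(ℝ, E) x₀ x (A (constField x₀ v x)) := rfl

theorem endCoord_tangentCoord (hx : x ∈ (chartAt E x₀).source) (A : EndFiber E x)
    (X : TangentSpace 𝓘(ℝ, E) x) :
    endCoord x₀ x A (tangentCoord 𝓘(ℝ, E) x₀ x X) = tangentCoord 𝓘(ℝ, E) x₀ x (A X) := by
  rw [endCoord_apply, constField, tangentCoordSymm_tangentCoord hx]

theorem endCoord_comp (hx : x ∈ (chartAt E x₀).source) (A B : EndFiber E x) :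
    endCoord x₀ x (A ∘L B) = endCoord x₀ x A * endCoord x₀ x B := by
  ext v
  rw [mul_apply_eq_comp, endCoord_apply x₀ x B, endCoord_tangentCoord hx]
  rfl

/-- The coordinate expression of a section of `End(TM)` in the preferred chart at `x₀`. -/
def coordEndField (x₀ : M) (s : Π x : M, EndFiber E x) (y : E) : E →L[ℝ] E :=
  endCoord x₀ ((extChartAt 𝓘(ℝ, E) x₀).symm y) (s ((extChartAt 𝓘(ℝ, E) x₀).symm y))

variable {q₀ q : EndBundle E M}

theorem mem_chartAt_source_endBundle :
    q ∈ (chartAt (ModelProd E (E →L[ℝ] E)) q₀).source ↔ q.1 ∈ (chartAt E q₀.1).source := by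
  simp only [FiberBundle.chartedSpace_chartAt, mfld_simps]
  exact and_iff_right_of_imp id

theorem extChartAt_target_endBundle (q₀ : EndBundle E M) :
    (extChartAt (endModel E) q₀).target = (chartAt (ModelProd E (E →L[ℝ] E)) q₀).target := by
  simp only [extChartAt_target, modelWithCornersSelf_coe_symm, modelWithCorners_prod_coe_symm,
    modelWithCorners_prod_coe, modelWithCornersSelf_coe, Prod.map_id, Set.range_id,
    Set.inter_univ, Set.preimage_id]

theorem extChartAt_endBundle (q₀ q : EndBundle E M) :
    extChartAt (endModel E) q₀ q = (extChartAt 𝓘(ℝ, E) q₀.1 q.1, endCoord q₀.1 q.1 q.2) := by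
  change chartAt (ModelProd E (E →L[ℝ] E)) q₀ q = _
  rw [hom_chart]
  rfl

theorem tangentCoord_verticalLift (hq : q.1 ∈ (chartAt E q₀.1).source) (B : EndFiber E q.1) :
    tangentCoord (endModel E) q₀ q (verticalLift q B) = (0, endCoord q₀.1 q.1 B) := by
  let c : (E →L[ℝ] E) →L[ℝ] E →L[ℝ] E := endCoord q₀.1 q.1
  have h := HasMFDerivAt.comp (f := fun A : E →L[ℝ] E => (⟨q.1, A⟩ : EndBundle E M)) _
    (hasMFDerivAt_extChartAt (mem_chartAt_source_endBundle.2 hq)) (hasMFDerivAt_fiber_inclusion q)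
  have hfiber : extChartAt (endModel E) q₀ ∘ (fun A : E →L[ℝ] E => (⟨q.1, A⟩ : EndBundle E M)) =
      fun A => (extChartAt 𝓘(ℝ, E) q₀.1 q.1, c A) :=
    funext fun A => extChartAt_endBundle q₀ ⟨q.1, A⟩
  have h' : HasFDerivAt (fun A : E →L[ℝ] E => (extChartAt 𝓘(ℝ, E) q₀.1 q.1, c A))
      ((0 : (E →L[ℝ] E) →L[ℝ] E).prod c) q.2 :=
    (hasFDerivAt_const _ _).prodMk c.hasFDerivAt
  rw [hfiber] at h
  exact congrArg (fun f => f B) (hasMFDerivAt_unique h h'.hasMFDerivAt)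

theorem extChartAt_section_comp_symm_eventuallyEq (s : Π x : M, EndFiber E x)
    (hx : x ∈ (chartAt E q₀.1).source) :
    (fun y => extChartAt (endModel E) q₀ (⟨y, s y⟩ : EndBundle E M)) ∘
        (extChartAt 𝓘(ℝ, E) q₀.1).symm
      =ᶠ[𝓝 (extChartAt 𝓘(ℝ, E) q₀.1 x)] fun y => (y, coordEndField q₀.1 s y) := by
  filter_upwards [(isOpen_extChartAt_target q₀.1).mem_nhds (extChartAt_mem_target _ hx)] with y hy
  simp only [Function.comp_apply, extChartAt_endBundle, (extChartAt 𝓘(ℝ, E) q₀.1).right_inv hy]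
  rfl

theorem hasMFDerivAt_extChartAt_section {s : Π x : M, EndFiber E x}
    (hx : x ∈ (chartAt E q₀.1).source)
    (hs : MDifferentiableAt 𝓘(ℝ, E) (endModel E) (fun y => (⟨y, s y⟩ : EndBundle E M)) x) :
    HasMFDerivAt 𝓘(ℝ, E) 𝓘(ℝ, E × (E →L[ℝ] E))
      (fun y => extChartAt (endModel E) q₀ (⟨y, s y⟩ : EndBundle E M)) x
      (tangentCoord (endModel E) q₀ ⟨x, s x⟩ ∘L
        mfderiv 𝓘(ℝ, E) (endModel E) (fun y => (⟨y, s y⟩ : EndBundle E M)) x) :=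
  HasMFDerivAt.comp (f := fun y => (⟨y, s y⟩ : EndBundle E M)) x
    (hasMFDerivAt_extChartAt (x := (⟨x, s x⟩ : EndBundle E M)) (mem_chartAt_source_endBundle.2 hx))
    hs.hasMFDerivAt

theorem differentiableAt_coordEndField {s : Π x : M, EndFiber E x}
    (hx : x ∈ (chartAt E q₀.1).source)
    (hs : MDifferentiableAt 𝓘(ℝ, E) (endModel E) (fun y => (⟨y, s y⟩ : EndBundle E M)) x) :
    DifferentiableAt ℝ (coordEndField q₀.1 s) (extChartAt 𝓘(ℝ, E) q₀.1 x) :=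
  ((differentiableAt_comp_extChartAt_symm hx
    (hasMFDerivAt_extChartAt_section hx hs).mdifferentiableAt).congr_of_eventuallyEq
    (extChartAt_section_comp_symm_eventuallyEq s hx).symm).snd

theorem tangentCoord_mfderiv_section {s : Π x : M, EndFiber E x}
    (hx : x ∈ (chartAt E q₀.1).source)
    (hs : MDifferentiableAt 𝓘(ℝ, E) (endModel E) (fun y => (⟨y, s y⟩ : EndBundle E M)) x)
    (X : TangentSpace 𝓘(ℝ, E) x) :
    tangentCoord (endModel E) q₀ ⟨x, s x⟩
        (mfderiv 𝓘(ℝ, E) (endModel E) (fun y => (⟨y, s y⟩ : EndBundle E M)) x X) =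
      (tangentCoord 𝓘(ℝ, E) q₀.1 x X, fderiv ℝ (coordEndField q₀.1 s)
        (extChartAt 𝓘(ℝ, E) q₀.1 x) (tangentCoord 𝓘(ℝ, E) q₀.1 x X)) := by
  have h := hasMFDerivAt_extChartAt_section (q₀ := q₀) hx hs
  have h' := hasMFDerivAt_fderiv_comp_tangentCoord hx h.mdifferentiableAt
  have hgraph : HasFDerivAt (fun y => (y, coordEndField q₀.1 s y))
      ((ContinuousLinearMap.id ℝ E).prod
        (fderiv ℝ (coordEndField q₀.1 s) (extChartAt 𝓘(ℝ, E) q₀.1 x)))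
      (extChartAt 𝓘(ℝ, E) q₀.1 x) :=
    (hasFDerivAt_id _).prodMk (differentiableAt_coordEndField (q₀ := q₀) hx hs).hasFDerivAt
  have hcoord := (extChartAt_section_comp_symm_eventuallyEq s hx).fderiv_eq.trans hgraph.fderiv
  exact (congrArg (fun f => f X) (hasMFDerivAt_unique h h')).trans
    (congrArg (fun f : E →L[ℝ] E × (E →L[ℝ] E) => f (tangentCoord 𝓘(ℝ, E) q₀.1 x X)) hcoord)

theorem tangentCoord_sectionThroughDeriv (hq : q.1 ∈ (chartAt E q₀.1).source)
    (X : TangentSpace 𝓘(ℝ, E) q.1) :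
    tangentCoord (endModel E) q₀ q (sectionThroughDeriv q X) =
      (tangentCoord 𝓘(ℝ, E) q₀.1 q.1 X, fderiv ℝ (coordEndField q₀.1 (sectionThrough q))
        (extChartAt 𝓘(ℝ, E) q₀.1 q.1) (tangentCoord 𝓘(ℝ, E) q₀.1 q.1 X)) := by
  have h := tangentCoord_mfderiv_section (q₀ := q₀) hq (sectionThrough_mdifferentiableAt q) X
  rwa [sectionThrough_self] at h

theorem fderiv_coordField_apply_constField {s : Π x : M, EndFiber E x}
    (hs : DifferentiableAt ℝ (coordEndField x₀ s) (extChartAt 𝓘(ℝ, E) x₀ x)) (u v : E) :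
    fderiv ℝ (coordField x₀ fun y => s y (constField x₀ v y)) (extChartAt 𝓘(ℝ, E) x₀ x) u =
      fderiv ℝ (coordEndField x₀ s) (extChartAt 𝓘(ℝ, E) x₀ x) u v := by
  have h : HasFDerivAt (coordField x₀ fun y => s y (constField x₀ v y)) _
      (extChartAt 𝓘(ℝ, E) x₀ x) :=
    hs.hasFDerivAt.clm_apply (hasFDerivAt_const v _)
  rw [h.fderiv, ContinuousLinearMap.comp_zero, zero_add, ContinuousLinearMap.flip_apply]

end EndCoord

section NaturalComplexStructure

variable {E : Type*} [NormedAddCommGroup E] [NormedSpace ℝ E] [FiniteDimensional ℝ E]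
  {M : Type*} [TopologicalSpace M] [ChartedSpace E M] [IsManifold 𝓘(ℝ, E) ∞ M] {x₀ x : M}
  {q₀ q : EndBundle E M}

theorem endDeriv_apply (D : LinearConnection E M) {s : Π x : M, EndFiber E x}
    (hs : MDifferentiableAt 𝓘(ℝ, E) (endModel E) (fun y => (⟨y, s y⟩ : EndBundle E M)) x)
    (X : TangentSpace 𝓘(ℝ, E) x) {Y : Π x : M, TangentSpace 𝓘(ℝ, E) x}
    (hY : MDifferentiableAt 𝓘(ℝ, E) (𝓘(ℝ, E).prod 𝓘(ℝ, E))
      (fun x => (⟨x, Y x⟩ : TangentBundle 𝓘(ℝ, E) M)) x) :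
    endDeriv D s x hs X (Y x) = D (fun y => s y (Y y)) x X - s x (D Y x X) :=
  (endDeriv_tensorial D s x hs X).pointwise (σ := FiberBundle.extend E (Y x)) (σ' := Y)
    (FiberBundle.mdifferentiableAt_extend ..) hY (by simp)

theorem endCoord_endDeriv (D : LinearConnection E M) {s : Π x : M, EndFiber E x}
    (hx : x ∈ (chartAt E q₀.1).source)
    (hs : MDifferentiableAt 𝓘(ℝ, E) (endModel E) (fun y => (⟨y, s y⟩ : EndBundle E M)) x)
    (X : TangentSpace 𝓘(ℝ, E) x) :
    endCoord q₀.1 x (endDeriv D s x hs X) =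
      fderiv ℝ (coordEndField q₀.1 s) (extChartAt 𝓘(ℝ, E) q₀.1 x)
          (tangentCoord 𝓘(ℝ, E) q₀.1 x X) +
        inducedSymbol (connectionSymbol D q₀.1 x) (endCoord q₀.1 x (s x))
          (tangentCoord 𝓘(ℝ, E) q₀.1 x X) := by
  ext v
  have hv := mdifferentiableAt_constField hx v
  rw [endCoord_apply, endDeriv_apply D hs X hv, map_sub,
    tangentCoord_connection D hx (σ := fun y => s y (constField q₀.1 v y)) (hs.clm_bundle_apply hv),
    fderiv_coordField_apply_constField (differentiableAt_coordEndField hx hs),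
    ← endCoord_apply, ← endCoord_tangentCoord hx (s x) (D (constField q₀.1 v) x X),
    tangentCoord_connection_constField D hx, add_apply, inducedSymbol_apply, sub_apply,
    mul_apply_eq_comp, mul_apply_eq_comp, add_sub_assoc]

theorem tangentCoord_horizontalLift (D : LinearConnection E M)
    (hq : q.1 ∈ (chartAt E q₀.1).source) (X : TangentSpace 𝓘(ℝ, E) q.1) :
    tangentCoord (endModel E) q₀ q (horizontalLift D q X) =
      (tangentCoord 𝓘(ℝ, E) q₀.1 q.1 X, -inducedSymbol (connectionSymbol D q₀.1 q.1)
        (endCoord q₀.1 q.1 q.2) (tangentCoord 𝓘(ℝ, E) q₀.1 q.1 X)) := by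
  have h : horizontalLift D q X = sectionThroughDeriv q X - verticalLift q
      (endDeriv D (sectionThrough q) q.1 (sectionThrough_mdifferentiableAt q) X) := rfl
  have hq_self : sectionThrough q q.1 = q.2 := by simp [sectionThrough]
  rw [h, map_sub, tangentCoord_sectionThroughDeriv hq, tangentCoord_verticalLift hq,
    endCoord_endDeriv D hq, hq_self, Prod.mk_sub_mk, sub_zero, sub_add_cancel_left]

theorem tangentCoord_naturalComplexStructure (D : LinearConnection E M)
    (hq : q.1 ∈ (chartAt E q₀.1).source) (w : TangentSpace (endModel E) q) :
    tangentCoord (endModel E) q₀ q (naturalComplexStructure D q w) =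
      modelComplexStructure (connectionSymbol D q₀.1 q.1) (endCoord q₀.1 q.1 q.2)
        (tangentCoord (endModel E) q₀ q w) := by
  obtain ⟨⟨X, B⟩, rfl⟩ := (splitting D q).surjective w
  rw [splitting_apply, naturalComplexStructure_apply, map_add, map_add,
    tangentCoord_horizontalLift D hq, tangentCoord_horizontalLift D hq,
    tangentCoord_verticalLift hq, tangentCoord_verticalLift hq, endCoord_comp hq,
    ← endCoord_tangentCoord hq]
  refine ext_verticalPart (Γ := connectionSymbol D q₀.1 q.1) (a := endCoord q₀.1 q.1 q.2) ?_ ?_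
  · simp only [Prod.mk_add_mk, add_zero, modelComplexStructure_apply]
  · rw [verticalPart_modelComplexStructure]
    simp only [Prod.mk_add_mk, add_zero, verticalPart_apply, neg_add_cancel_comm]

end NaturalComplexStructure

/-! ### The Levi-Civita connection in coordinates -/

section LieBracket

variable {E : Type*} [NormedAddCommGroup E] [NormedSpace ℝ E]
  {M : Type*} [TopologicalSpace M] [ChartedSpace E M] [IsManifold 𝓘(ℝ, E) ∞ M] {x₀ x : M}

theorem contMDiffAt_constField (hx : x ∈ (chartAt E x₀).source) (v : E) :
    ContMDiffAt 𝓘(ℝ, E) (𝓘(ℝ, E).prod 𝓘(ℝ, E)) ∞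
      (fun x => (⟨x, constField x₀ v x⟩ : TangentBundle 𝓘(ℝ, E) M)) x := by
  rw [(trivializationAt E (TangentSpace 𝓘(ℝ, E)) x₀).contMDiffAt_section_iff hx]
  refine (contMDiffAt_const (c := v)).congr_of_eventuallyEq ?_
  filter_upwards [(chartAt E x₀).open_source.mem_nhds hx] with z hz
  exact ((trivializationAt E (TangentSpace 𝓘(ℝ, E)) x₀).continuousLinearMapAt_apply_of_mem ℝ hz
    _).symm.trans (tangentCoord_constField hz v)

/-- The vector field on a vector space with constant value `v`. -/
def constVectorField (v : E) (y : E) : TangentSpace 𝓘(ℝ, E) y := v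

theorem mlieBracket_constVectorField (v w y : E) :
    VectorField.mlieBracket 𝓘(ℝ, E) (constVectorField v) (constVectorField w) y = 0 := by
  rw [← VectorField.mlieBracketWithin_univ, VectorField.mlieBracketWithin_eq_lieBracketWithin]
  change fderivWithin ℝ (fun _ : E => w) Set.univ y v -
    fderivWithin ℝ (fun _ : E => v) Set.univ y w = (0 : E)
  simp

theorem constField_eventuallyEq_mpullback (hx : x ∈ (chartAt E x₀).source) (v : E) :
    constField x₀ v =ᶠ[𝓝 x] VectorField.mpullback 𝓘(ℝ, E) 𝓘(ℝ, E) (extChartAt 𝓘(ℝ, E) x₀)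
      (constVectorField v) := by
  filter_upwards [(chartAt E x₀).open_source.mem_nhds hx] with z hz
  rw [VectorField.mpullback_apply, (hasMFDerivAt_extChartAt hz).mfderiv]
  let L : TangentSpace 𝓘(ℝ, E) z ≃L[ℝ] E :=
    ContinuousLinearEquiv.equivOfInverse (tangentCoord 𝓘(ℝ, E) x₀ z) (tangentCoordSymm 𝓘(ℝ, E) x₀ z)
      (tangentCoordSymm_tangentCoord hz) (tangentCoord_tangentCoordSymm hz)
  exact (congrArg (fun f => f v) (ContinuousLinearMap.inverse_equiv L)).symm

theorem mlieBracket_constField [CompleteSpace E] (hx : x ∈ (chartAt E x₀).source) (v w : E) :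
    VectorField.mlieBracket 𝓘(ℝ, E) (constField x₀ v) (constField x₀ w) x = 0 := by
  have : IsManifold 𝓘(ℝ, E) (minSmoothness ℝ 2) M := by
    rw [minSmoothness_of_isRCLikeNormedField]
    infer_instance
  have hsmooth : minSmoothness ℝ 2 ≤ ∞ := by
    rw [minSmoothness_of_isRCLikeNormedField]
    exact WithTop.coe_le_coe.2 le_top
  have hconst (u y : E) : MDifferentiableAt 𝓘(ℝ, E) 𝓘(ℝ, E).tangent
      (fun y => (⟨y, constVectorField u y⟩ : TangentBundle 𝓘(ℝ, E) E)) y := by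
    rw [mdifferentiableAt_totalSpace]
    exact ⟨mdifferentiableAt_id, by simpa [constVectorField] using mdifferentiableAt_const⟩
  rw [(constField_eventuallyEq_mpullback hx v).mlieBracket_vectorField_eq
      (constField_eventuallyEq_mpullback hx w),
    ← VectorField.mpullback_mlieBracket (n := ∞) (hconst v _) (hconst w _)
      (contMDiffAt_extChartAt' hx) hsmooth,
    VectorField.mpullback_apply, mlieBracket_constVectorField, map_zero]

end LieBracket

section CoordMetric

variable {E : Type*} [NormedAddCommGroup E] [NormedSpace ℝ E]
  [FiniteDimensional ℝ E] {M : Type*} [TopologicalSpace M] [ChartedSpace E M]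
  [IsManifold 𝓘(ℝ, E) ∞ M] {x₀ x : M}

/-- The coordinate expression, in the preferred chart at `x₀`, of a metric at the point `x`. -/
def metricAt (g : RiemMetric E M) (x₀ x : M) : E →L[ℝ] E →L[ℝ] ℝ :=
  (LinearMap.mk₂ ℝ
    (fun v w => g.inner x (tangentCoordSymm 𝓘(ℝ, E) x₀ x v) (tangentCoordSymm 𝓘(ℝ, E) x₀ x w))
    (fun v v' w => by simp only [map_add, add_apply])
    (fun c v w => by simp only [map_smul, smul_apply])
    (fun v w w' => by simp only [map_add])
    (fun c v w => by simp only [map_smul])).toContinuousBilinearMap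

theorem metricAt_apply (g : RiemMetric E M) (x₀ x : M) (v w : E) :
    metricAt g x₀ x v w = g.inner x (constField x₀ v x) (constField x₀ w x) := rfl

theorem metricAt_tangentCoord (g : RiemMetric E M) (hx : x ∈ (chartAt E x₀).source)
    (X Y : TangentSpace 𝓘(ℝ, E) x) :
    metricAt g x₀ x (tangentCoord 𝓘(ℝ, E) x₀ x X) (tangentCoord 𝓘(ℝ, E) x₀ x Y) =
      g.inner x X Y := by
  rw [metricAt_apply, constField, constField, tangentCoordSymm_tangentCoord hx,
    tangentCoordSymm_tangentCoord hx]

theorem isMetricForm_metricAt (g : RiemMetric E M) (hx : x ∈ (chartAt E x₀).source) :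
    IsMetricForm (metricAt g x₀ x) where
  symm v w := g.symm _ _ _
  pos v hv := by
    refine g.pos _ _ fun h => hv ?_
    rw [← tangentCoord_constField hx v, constField, h, map_zero]

/-- The coordinate expression of a metric in the preferred chart at `x₀`. -/
def coordMetric (g : RiemMetric E M) (x₀ : M) (y : E) : E →L[ℝ] E →L[ℝ] ℝ :=
  metricAt g x₀ ((extChartAt 𝓘(ℝ, E) x₀).symm y)

theorem coordMetric_extChartAt (g : RiemMetric E M) (hx : x ∈ (chartAt E x₀).source) :
    coordMetric g x₀ (extChartAt 𝓘(ℝ, E) x₀ x) = metricAt g x₀ x := by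
  rw [coordMetric, extChartAt_left_inv _ hx]

theorem isMetricForm_coordMetric (g : RiemMetric E M) (x₀ : M) :
    ∀ y ∈ (extChartAt 𝓘(ℝ, E) x₀).target, IsMetricForm (coordMetric g x₀ y) :=
  fun _ hy => isMetricForm_metricAt g (extChartAt_symm_mem_source _ hy)

theorem contMDiffAt_metricAt (g : RiemMetric E M) (hx : x ∈ (chartAt E x₀).source) (v w : E) :
    ContMDiffAt 𝓘(ℝ, E) 𝓘(ℝ, ℝ) ∞ (fun x => metricAt g x₀ x v w) x := by
  have h : ContMDiffAt 𝓘(ℝ, E) (𝓘(ℝ, E).prod 𝓘(ℝ, ℝ)) ∞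
      (fun z => TotalSpace.mk' ℝ (E := Bundle.Trivial M ℝ) z
        (g.inner z (constField x₀ v z) (constField x₀ w z))) x :=
    ContMDiffAt.clm_bundle_apply₂ (F₁ := E) (F₂ := E) (g.contMDiff x)
      (contMDiffAt_constField hx v) (contMDiffAt_constField hx w)
  exact (contMDiffAt_totalSpace.1 h).2

theorem contDiffOn_coordMetric (g : RiemMetric E M) (x₀ : M) :
    ContDiffOn ℝ ∞ (coordMetric g x₀) (extChartAt 𝓘(ℝ, E) x₀).target := by
  refine contDiffOn_clm_apply.2 fun v => contDiffOn_clm_apply.2 fun w => ?_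
  rw [← contMDiffOn_iff_contDiffOn]
  intro y hy
  exact ContMDiffAt.comp_contMDiffWithinAt y
    (contMDiffAt_metricAt g (extChartAt_symm_mem_source _ hy) v w)
    (contMDiffOn_extChartAt_symm x₀ y hy)

theorem differentiableAt_coordMetric (g : RiemMetric E M) (hx : x ∈ (chartAt E x₀).source) :
    DifferentiableAt ℝ (coordMetric g x₀) (extChartAt 𝓘(ℝ, E) x₀ x) :=
  ((contDiffOn_coordMetric g x₀).contDiffAt ((isOpen_extChartAt_target x₀).mem_nhds
    (extChartAt_mem_target _ hx))).differentiableAt (by simp)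

theorem mvfderiv_metricAt (g : RiemMetric E M) (hx : x ∈ (chartAt E x₀).source) (u v w : E) :
    mvfderiv 𝓘(ℝ, E) (fun x => metricAt g x₀ x v w) x (constField x₀ u x) =
      fderiv ℝ (coordMetric g x₀) (extChartAt 𝓘(ℝ, E) x₀ x) u v w := by
  have hcoord : fderiv ℝ ((fun x => metricAt g x₀ x v w) ∘ (extChartAt 𝓘(ℝ, E) x₀).symm)
      (extChartAt 𝓘(ℝ, E) x₀ x) u =
      fderiv ℝ (coordMetric g x₀) (extChartAt 𝓘(ℝ, E) x₀ x) u v w := by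
    have h := ((differentiableAt_coordMetric g hx).hasFDerivAt.clm_apply
      (hasFDerivAt_const v _)).clm_apply (hasFDerivAt_const w _)
    refine (congrArg (fun f => f u) h.fderiv).trans ?_
    simp
  have hmfderiv := hasMFDerivAt_fderiv_comp_tangentCoord hx
    ((contMDiffAt_metricAt g hx v w).mdifferentiableAt (by simp))
  rw [← hcoord, mvfderiv, hmfderiv.mfderiv]
  exact congrArg (fderiv ℝ _ _) (tangentCoord_constField hx u)

theorem fderiv_coordMetric_symm (g : RiemMetric E M) (hx : x ∈ (chartAt E x₀).source)
    (u v w : E) : fderiv ℝ (coordMetric g x₀) (extChartAt 𝓘(ℝ, E) x₀ x) u v w =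
      fderiv ℝ (coordMetric g x₀) (extChartAt 𝓘(ℝ, E) x₀ x) u w v := by
  have hsymm : (fun x => metricAt g x₀ x v w) = fun x => metricAt g x₀ x w v :=
    funext fun x => g.symm x _ _
  rw [← mvfderiv_metricAt g hx, ← mvfderiv_metricAt g hx, hsymm]

end CoordMetric

section LeviCivita

variable {E : Type*} [NormedAddCommGroup E] [NormedSpace ℝ E] [FiniteDimensional ℝ E]
  {M : Type*} [TopologicalSpace M] [ChartedSpace E M] [IsManifold 𝓘(ℝ, E) ∞ M] {x₀ x : M}
  {g : RiemMetric E M} {D : LinearConnection E M}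

theorem tangentCoord_torsion (D : LinearConnection E M) (hx : x ∈ (chartAt E x₀).source)
    (X Y : TangentSpace 𝓘(ℝ, E) x) : tangentCoord 𝓘(ℝ, E) x₀ x (D.torsion x X Y) =
      connectionSymbol D x₀ x (tangentCoord 𝓘(ℝ, E) x₀ x X) (tangentCoord 𝓘(ℝ, E) x₀ x Y) -
        connectionSymbol D x₀ x (tangentCoord 𝓘(ℝ, E) x₀ x Y)
          (tangentCoord 𝓘(ℝ, E) x₀ x X) := by
  have h := CovariantDerivative.torsion_apply D
    (mdifferentiableAt_constField hx (tangentCoord 𝓘(ℝ, E) x₀ x X))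
    (mdifferentiableAt_constField hx (tangentCoord 𝓘(ℝ, E) x₀ x Y))
  rw [mlieBracket_constField hx, sub_zero, constField, constField,
    tangentCoordSymm_tangentCoord hx, tangentCoordSymm_tangentCoord hx] at h
  rw [h, map_sub, tangentCoord_connection_constField D hx,
    tangentCoord_connection_constField D hx]

theorem torsion_eq_zero_iff_connectionSymbol (D : LinearConnection E M)
    (hx : x ∈ (chartAt E x₀).source) : D.torsion x = 0 ↔
      ∀ u v, connectionSymbol D x₀ x u v = connectionSymbol D x₀ x v u := by
  refine ⟨fun h u v => ?_, fun h => ?_⟩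
  · have huv := tangentCoord_torsion D hx (constField x₀ u x) (constField x₀ v x)
    rw [h, tangentCoord_constField hx, tangentCoord_constField hx] at huv
    exact sub_eq_zero.1 (huv.symm.trans (map_zero (tangentCoord 𝓘(ℝ, E) x₀ x)))
  · refine ContinuousLinearMap.ext fun X => ContinuousLinearMap.ext fun Y =>
      tangentCoord_injective hx ?_
    rw [tangentCoord_torsion D hx, h, sub_self]
    exact (map_zero (tangentCoord 𝓘(ℝ, E) x₀ x)).symm

theorem derivMetricTensor_eq_coord (g : RiemMetric E M) (D : LinearConnection E M)
    (hx : x ∈ (chartAt E x₀).source) (X Y Z : TangentSpace 𝓘(ℝ, E) x) :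
    letI : RiemannianBundle (fun x : M => TangentSpace 𝓘(ℝ, E) x) := ⟨g.toRiemannianMetric⟩
    CovariantDerivative.derivMetricTensor (F := E) (V := fun x : M => TangentSpace 𝓘(ℝ, E) x) D x
      Y Z X =
      fderiv ℝ (coordMetric g x₀) (extChartAt 𝓘(ℝ, E) x₀ x) (tangentCoord 𝓘(ℝ, E) x₀ x X)
          (tangentCoord 𝓘(ℝ, E) x₀ x Y) (tangentCoord 𝓘(ℝ, E) x₀ x Z) -
        metricAt g x₀ x (connectionSymbol D x₀ x (tangentCoord 𝓘(ℝ, E) x₀ x X)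
          (tangentCoord 𝓘(ℝ, E) x₀ x Y)) (tangentCoord 𝓘(ℝ, E) x₀ x Z) -
        metricAt g x₀ x (tangentCoord 𝓘(ℝ, E) x₀ x Y)
          (connectionSymbol D x₀ x (tangentCoord 𝓘(ℝ, E) x₀ x X)
            (tangentCoord 𝓘(ℝ, E) x₀ x Z)) := by
  let : RiemannianBundle (fun x : M => TangentSpace 𝓘(ℝ, E) x) := ⟨g.toRiemannianMetric⟩
  have hself (Z : TangentSpace 𝓘(ℝ, E) x) :
      constField x₀ (tangentCoord 𝓘(ℝ, E) x₀ x Z) x = Z := tangentCoordSymm_tangentCoord hx Z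
  have h := CovariantDerivative.derivMetricTensor_apply (F := E)
    (V := fun x : M => TangentSpace 𝓘(ℝ, E) x) D x
    (X := constField x₀ (tangentCoord 𝓘(ℝ, E) x₀ x X))
    (mdifferentiableAt_constField hx (tangentCoord 𝓘(ℝ, E) x₀ x Y))
    (mdifferentiableAt_constField hx (tangentCoord 𝓘(ℝ, E) x₀ x Z))
  rw [hself X, hself Y, hself Z] at h
  rw [h, ← mvfderiv_metricAt g hx, ← tangentCoord_connection_constField D hx,
    ← tangentCoord_connection_constField D hx, metricAt_tangentCoord g hx,
    metricAt_tangentCoord g hx]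
  simp only [hself]
  rfl

theorem derivMetricTensor_eq_zero_iff_connectionSymbol (g : RiemMetric E M)
    (D : LinearConnection E M) (hx : x ∈ (chartAt E x₀).source) :
    letI : RiemannianBundle (fun x : M => TangentSpace 𝓘(ℝ, E) x) := ⟨g.toRiemannianMetric⟩
    CovariantDerivative.derivMetricTensor (F := E) (V := fun x : M => TangentSpace 𝓘(ℝ, E) x) D x
        = 0 ↔
      ∀ u v w, fderiv ℝ (coordMetric g x₀) (extChartAt 𝓘(ℝ, E) x₀ x) u v w =
        metricAt g x₀ x (connectionSymbol D x₀ x u v) w +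
          metricAt g x₀ x v (connectionSymbol D x₀ x u w) := by
  refine ⟨fun h u v w => ?_, fun h => ?_⟩
  · have huvw := derivMetricTensor_eq_coord g D hx (constField x₀ u x) (constField x₀ v x)
      (constField x₀ w x)
    rw [h, tangentCoord_constField hx, tangentCoord_constField hx, tangentCoord_constField hx,
      sub_sub] at huvw
    exact sub_eq_zero.1 huvw.symm
  · refine ContinuousLinearMap.ext fun Y => ContinuousLinearMap.ext fun Z =>
      ContinuousLinearMap.ext fun X => (derivMetricTensor_eq_coord g D hx X Y Z).trans ?_
    rw [h, sub_sub, sub_self]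
    rfl

theorem IsLeviCivita.isLeviCivitaSymbol (hD : IsLeviCivita g D)
    (hx : x ∈ (chartAt E x₀).source) :
    IsLeviCivitaSymbol (metricAt g x₀ x) (fderiv ℝ (coordMetric g x₀) (extChartAt 𝓘(ℝ, E) x₀ x))
      (connectionSymbol D x₀ x) where
  symm := (torsion_eq_zero_iff_connectionSymbol D hx).1 (congrFun hD.1 x)
  metric := (derivMetricTensor_eq_zero_iff_connectionSymbol g D hx).1 (congrFun hD.2 x)

theorem isLeviCivita_of_isLeviCivitaSymbol (h : ∀ x : M, IsLeviCivitaSymbol (metricAt g x x)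
    (fderiv ℝ (coordMetric g x) (extChartAt 𝓘(ℝ, E) x x)) (connectionSymbol D x x)) :
    IsLeviCivita g D :=
  ⟨funext fun x => (torsion_eq_zero_iff_connectionSymbol D (mem_chart_source E x)).2 (h x).symm,
    funext fun x =>
      (derivMetricTensor_eq_zero_iff_connectionSymbol g D (mem_chart_source E x)).2 (h x).metric⟩

/-- The linear connection whose Christoffel symbol at each point `x`, in the preferred chart at `x`,
is `Γ x`. -/
def connectionOfSymbol (Γ : M → E →L[ℝ] E →L[ℝ] E) : LinearConnection E M where
  toFun σ x := flatConnection x σ x + tangentCoordSymm 𝓘(ℝ, E) x x ∘L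
    (Γ x).flip (tangentCoord 𝓘(ℝ, E) x x (σ x)) ∘L tangentCoord 𝓘(ℝ, E) x x
  isCovariantDerivativeOnUniv :=
    { add := fun {σ σ' x} hσ hσ' _ => by
        have h := (isCovariantDerivativeOn_flatConnection x).add hσ hσ' (mem_chart_source E x)
        have h' : tangentCoord 𝓘(ℝ, E) x x ((σ + σ') x) =
          tangentCoord 𝓘(ℝ, E) x x (σ x) + tangentCoord 𝓘(ℝ, E) x x (σ' x) := map_add _ _ _
        rw [h, h']
        ext X
        simp only [add_apply, map_add, ContinuousLinearMap.comp_apply]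
        abel
      leibniz := fun {σ f x} hσ hf _ => by
        have h := (isCovariantDerivativeOn_flatConnection x).leibniz hσ hf (mem_chart_source E x)
        have h' : tangentCoord 𝓘(ℝ, E) x x ((f • σ) x) =
          f x • tangentCoord 𝓘(ℝ, E) x x (σ x) := map_smul _ _ _
        rw [h, h']
        ext X
        simp only [add_apply, map_smul, smul_apply, smul_add, ContinuousLinearMap.comp_apply]
        abel }

theorem connectionSymbol_connectionOfSymbol (Γ : M → E →L[ℝ] E →L[ℝ] E) (x : M) :
    connectionSymbol (connectionOfSymbol Γ) x x = Γ x := by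
  have hx := mem_chart_source E x
  ext u v
  have h : connectionOfSymbol Γ (constField x v) x (constField x u x) =
      tangentCoordSymm 𝓘(ℝ, E) x x (fderiv ℝ (coordField x (constField x v))
        (extChartAt 𝓘(ℝ, E) x x) (tangentCoord 𝓘(ℝ, E) x x (constField x u x))) +
      tangentCoordSymm 𝓘(ℝ, E) x x (Γ x (tangentCoord 𝓘(ℝ, E) x x (constField x u x))
        (tangentCoord 𝓘(ℝ, E) x x (constField x v x))) := rfl
  have hsymbol := tangentCoord_connection_constField (connectionOfSymbol Γ) hx v (constField x u x)
  rw [h, map_add, tangentCoord_tangentCoordSymm hx, tangentCoord_tangentCoordSymm hx,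
    (coordField_constField_eventuallyEq hx v).fderiv_eq, fderiv_const_apply, zero_apply, zero_add,
    tangentCoord_constField hx, tangentCoord_constField hx] at hsymbol
  exact hsymbol.symm

theorem exists_isLeviCivita (g : RiemMetric E M) :
    ∃ D : LinearConnection E M, IsLeviCivita g D := by
  refine ⟨connectionOfSymbol fun x => christoffel (metricAt g x x)
    (fderiv ℝ (coordMetric g x) (extChartAt 𝓘(ℝ, E) x x)),
    isLeviCivita_of_isLeviCivitaSymbol fun x => ?_⟩
  rw [connectionSymbol_connectionOfSymbol]
  exact (isMetricForm_metricAt g (mem_chart_source E x)).isLeviCivitaSymbol_christoffel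
    (fderiv_coordMetric_symm g (mem_chart_source E x))

end LeviCivita

/-! ### The bundle of isometric complex structures -/

section SliceChart

variable {W : Type*} [NormedAddCommGroup W] [NormedSpace ℝ W]
  {HN : Type*} [TopologicalSpace HN] {IN : ModelWithCorners ℝ W HN}
  {N : Type*} [TopologicalSpace N] [ChartedSpace HN N]
  {S : Set N} {F : Submodule ℝ W} {φ : OpenPartialHomeomorph N W}

variable (IN S F φ) in
/-- The local diffeomorphism `φ` maps `S` onto the trace of the vector subspace `F`, as in the
definition of an embedded submanifold. -/
structure IsSliceChart : Prop where
  contMDiffOn : ContMDiffOn IN 𝓘(ℝ, W) ∞ φ φ.source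
  contMDiffOn_symm : ContMDiffOn 𝓘(ℝ, W) IN ∞ φ.symm φ.target
  mem_iff : ∀ q ∈ φ.source, q ∈ S ↔ φ q ∈ F

theorem IsSliceChart.mfderiv_symm_mem_tangentSubspace (h : IsSliceChart IN S F φ) {y w : W}
    (hy : y ∈ φ.target) (hyF : y ∈ F) (hw : w ∈ F) :
    mfderiv 𝓘(ℝ, W) IN φ.symm y w ∈ tangentSubspace IN S (φ.symm y) := by
  let line : ℝ → W := fun t => y + t • w
  have hline : ContDiff ℝ ∞ line := contDiff_const.add (contDiff_id.smul contDiff_const)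
  have hline0 : line 0 = y := by simp only [line, zero_smul, add_zero]
  have hmem : line ⁻¹' φ.target ∈ 𝓝 0 :=
    hline.continuous.continuousAt.preimage_mem_nhds (φ.open_target.mem_nhds (hline0 ▸ hy))
  obtain ⟨ε, hε, hball⟩ := Metric.mem_nhds_iff.1 hmem
  rw [Real.ball_eq_Ioo, zero_sub, zero_add] at hball
  refine Submodule.subset_span ⟨ε, hε, φ.symm ∘ line,
    h.contMDiffOn_symm.comp hline.contMDiff.contMDiffOn hball, fun t ht => ?_, ?_⟩
  · rw [Function.comp_apply, h.mem_iff _ (φ.map_target (hball ht)), φ.right_inv (hball ht)]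
    exact F.add_mem hyF (F.smul_mem t hw)
  · have hderiv :
        HasMFDerivAt 𝓘(ℝ, ℝ) 𝓘(ℝ, W) line 0 (ContinuousLinearMap.toSpanSingleton ℝ w) := by
      have hd := ((hasDerivAt_id (0 : ℝ)).smul_const w).const_add y
      rw [one_smul] at hd
      exact hd.hasFDerivAt.hasMFDerivAt
    have hsymm : MDifferentiableAt 𝓘(ℝ, W) IN φ.symm (line 0) :=
      (h.contMDiffOn_symm.contMDiffAt (φ.open_target.mem_nhds (hline0 ▸ hy))).mdifferentiableAt
        (by simp)
    have hvelocity : mfderiv 𝓘(ℝ, ℝ) IN (φ.symm ∘ line) 0 (1 : ℝ) =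
        mfderiv 𝓘(ℝ, W) IN φ.symm (line 0) w := by
      rw [(hsymm.hasMFDerivAt.comp 0 hderiv).mfderiv]
      exact congrArg (mfderiv 𝓘(ℝ, W) IN φ.symm (line 0)) (one_smul ℝ w)
    rw [hvelocity]
    exact congrArg (fun z => (⟨φ.symm z, mfderiv 𝓘(ℝ, W) IN φ.symm z w⟩ : TangentBundle IN N))
      hline0

theorem IsSliceChart.finrank_le_finrank_tangentSubspace [FiniteDimensional ℝ W]
    (h : IsSliceChart IN S F φ) {p : N} (hp : p ∈ φ.source) (hpS : p ∈ S) :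
    Module.finrank ℝ F ≤ Module.finrank ℝ (tangentSubspace IN S p) := by
  obtain ⟨y, hy, rfl⟩ : ∃ y ∈ φ.target, φ.symm y = p := ⟨φ p, φ.map_source hp, φ.left_inv hp⟩
  have hyF : y ∈ F := by simpa only [φ.right_inv hy] using (h.mem_iff _ hp).1 hpS
  have hφ : φ.MDifferentiable IN 𝓘(ℝ, W) :=
    ⟨h.contMDiffOn.mdifferentiableOn (by simp), h.contMDiffOn_symm.mdifferentiableOn (by simp)⟩
  let L : F →ₗ[ℝ] tangentSubspace IN S (φ.symm y) :=
    (mfderiv 𝓘(ℝ, W) IN φ.symm y).toLinearMap.restrict fun _ hw =>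
      h.mfderiv_symm_mem_tangentSubspace hy hyF hw
  have : FiniteDimensional ℝ (TangentSpace IN (φ.symm y)) := inferInstanceAs (FiniteDimensional ℝ W)
  refine LinearMap.finrank_le_finrank_of_injective (f := L) fun v w hvw => Subtype.ext ?_
  exact hφ.symm.mfderiv_injective hy (congrArg Subtype.val hvw)

end SliceChart

section Isometric

variable {E : Type*} [NormedAddCommGroup E] [NormedSpace ℝ E]
  {M : Type*} [TopologicalSpace M] [ChartedSpace E M] [IsManifold 𝓘(ℝ, E) ∞ M]
  {c : ConformalStructure E M} {g g' : RiemMetric E M} {x₀ x : M} {p J : EndBundle E M}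

theorem ConformalStructure.exists_isCompatible (c : ConformalStructure E M) :
    ∃ g, c.IsCompatible g :=
  Quotient.exists_rep c

theorem ConformalStructure.IsCompatible.conformallyRelated (hg : c.IsCompatible g)
    (hg' : c.IsCompatible g') : ConformallyRelated g g' :=
  Quotient.exact (hg.trans hg'.symm)

theorem mem_isometricComplexStructures_iff (hg : c.IsCompatible g) :
    J ∈ isometricComplexStructures c ↔ J ∈ complexStructures E M ∧
      ∀ X Y : TangentSpace 𝓘(ℝ, E) J.1, g.inner J.1 (J.2 X) (J.2 Y) = g.inner J.1 X Y := by
  refine and_congr_right fun _ => ⟨?_, fun h => ⟨g, hg, h⟩⟩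
  rintro ⟨g', hg', h⟩ X Y
  obtain ⟨φ, -, hφ⟩ := hg.conformallyRelated hg'
  exact mul_left_cancel₀ (Real.exp_ne_zero (2 * φ J.1)) (by rw [← hφ, ← hφ, h])

theorem mem_complexStructures_iff_endCoord (hx : J.1 ∈ (chartAt E x₀).source) :
    J ∈ complexStructures E M ↔ endCoord x₀ J.1 J.2 * endCoord x₀ J.1 J.2 = -1 := by
  rw [← endCoord_comp hx]
  refine ⟨fun h => ?_, fun h X => tangentCoord_injective hx ?_⟩
  · ext v
    have hJ : (J.2 ∘L J.2) (constField x₀ v J.1) = -constField x₀ v J.1 := h _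
    rw [endCoord_apply, hJ, map_neg, tangentCoord_constField hx]
    rfl
  · have hX := DFunLike.congr_fun h (tangentCoord 𝓘(ℝ, E) x₀ J.1 X)
    rw [endCoord_tangentCoord hx] at hX
    exact hX.trans (map_neg (tangentCoord 𝓘(ℝ, E) x₀ J.1) X).symm

variable [FiniteDimensional ℝ E]

theorem mem_isometricComplexStructures_iff_endCoord (hg : c.IsCompatible g)
    (hx : J.1 ∈ (chartAt E x₀).source) :
    J ∈ isometricComplexStructures c ↔
      IsIsometricComplex (metricAt g x₀ J.1) (endCoord x₀ J.1 J.2) := by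
  rw [mem_isometricComplexStructures_iff hg, mem_complexStructures_iff_endCoord hx]
  refine ⟨fun h => ⟨h.1, fun v w => ?_⟩, fun h => ⟨h.sq_eq, fun X Y => ?_⟩⟩
  · rw [endCoord_apply, endCoord_apply, metricAt_tangentCoord g hx, h.2, metricAt_apply]
  · rw [← metricAt_tangentCoord g hx, ← endCoord_tangentCoord hx, ← endCoord_tangentCoord hx,
      h.isometric, metricAt_tangentCoord g hx]

theorem mem_isometricComplexStructures_iff_extChartAt (hg : c.IsCompatible g)
    (hJ : J.1 ∈ (chartAt E p.1).source) :
    J ∈ isometricComplexStructures c ↔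
      IsIsometricComplex (coordMetric g p.1 (extChartAt (endModel E) p J).1)
        (extChartAt (endModel E) p J).2 := by
  rw [mem_isometricComplexStructures_iff_endCoord hg hJ, extChartAt_endBundle,
    coordMetric_extChartAt g hJ]

theorem exists_isSliceChart_isometricComplexStructures (hg : c.IsCompatible g)
    (hp : p ∈ isometricComplexStructures c) :
    ∃ φ : OpenPartialHomeomorph (EndBundle E M) (E × (E →L[ℝ] E)), p ∈ φ.source ∧
      IsSliceChart (endModel E) (isometricComplexStructures c)
        ((⊤ : Submodule ℝ E).prod (anticommutant ℝ (endCoord p.1 p.1 p.2) ⊓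
          skewEnd (metricAt g p.1 p.1))) φ := by
  have hps := mem_chart_source E p.1
  obtain ⟨F, -⟩ := exists_isometricFrame (isOpen_extChartAt_target p.1)
    (isMetricForm_coordMetric g p.1) (contDiffOn_coordMetric g p.1)
    (extChartAt_mem_target 𝓘(ℝ, E) hps)
  have ha : IsIsometricComplex (coordMetric g p.1 (extChartAt 𝓘(ℝ, E) p.1 p.1))
      (endCoord p.1 p.1 p.2) := by
    rw [coordMetric_extChartAt g hps]
    exact (mem_isometricComplexStructures_iff_endCoord hg hps).1 hp
  let e : OpenPartialHomeomorph (EndBundle E M) (E × (E →L[ℝ] E)) :=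
    chartAt (ModelProd E (E →L[ℝ] E)) p
  have he : ContMDiffOn (endModel E) 𝓘(ℝ, E × (E →L[ℝ] E)) ∞ e e.source :=
    contMDiffOn_extChartAt (I := endModel E) (x := p)
  have he' : ContMDiffOn 𝓘(ℝ, E × (E →L[ℝ] E)) (endModel E) ∞ e.symm e.target :=
    extChartAt_target_endBundle p ▸ contMDiffOn_extChartAt_symm (I := endModel E) p
  refine ⟨e.trans (F.flattening ha.sq_eq), ?_, ?_, ?_, fun q hq => ?_⟩
  · have hep : e p = (extChartAt 𝓘(ℝ, E) p.1 p.1, endCoord p.1 p.1 p.2) := extChartAt_endBundle p p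
    have hepF : e p ∈ (F.flattening ha.sq_eq).source := hep ▸ F.mem_flattening_source _
    exact ⟨mem_chartAt_source_endBundle.2 hps, hepF⟩
  · exact (F.contDiffOn_flattening _).contMDiffOn.comp (he.mono fun q hq => hq.1) fun q hq => hq.2
  · rw [OpenPartialHomeomorph.trans_target]
    exact he'.comp ((F.contDiffOn_flattening_symm _).contMDiffOn.mono fun w hw => hw.1)
      fun w hw => hw.2
  · rw [← coordMetric_extChartAt g hps]
    exact (mem_isometricComplexStructures_iff_extChartAt hg
      (mem_chartAt_source_endBundle.1 hq.1)).trans (F.flattening_mem_iff ha hq.2).symm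

theorem isEmbeddedSubmanifold_isometricComplexStructures (c : ConformalStructure E M) :
    IsEmbeddedSubmanifold (endModel E) (isometricComplexStructures c) := by
  intro p hp
  obtain ⟨g, hg⟩ := c.exists_isCompatible
  obtain ⟨φ, hpφ, hφ⟩ := exists_isSliceChart_isometricComplexStructures hg hp
  exact ⟨_, φ, hpφ, hφ.contMDiffOn, hφ.contMDiffOn_symm, hφ.mem_iff⟩

theorem fderiv_coordMetric_of_conformal {φ : M → ℝ} (hφ : ContMDiff 𝓘(ℝ, E) 𝓘(ℝ, ℝ) ∞ φ)
    (h : ∀ (x : M) (X Y : TangentSpace 𝓘(ℝ, E) x),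
      g'.inner x X Y = Real.exp (2 * φ x) * g.inner x X Y)
    (hx : x ∈ (chartAt E x₀).source) :
    fderiv ℝ (coordMetric g' x₀) (extChartAt 𝓘(ℝ, E) x₀ x) =
      Real.exp (2 * φ x) •
        ((2 • fderiv ℝ (φ ∘ (extChartAt 𝓘(ℝ, E) x₀).symm) (extChartAt 𝓘(ℝ, E) x₀ x)).smulRight
          (metricAt g x₀ x) + fderiv ℝ (coordMetric g x₀) (extChartAt 𝓘(ℝ, E) x₀ x)) := by
  have hmetric : coordMetric g' x₀ = fun y =>
      Real.exp (2 * (φ ∘ (extChartAt 𝓘(ℝ, E) x₀).symm) y) • coordMetric g x₀ y :=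
    funext fun y => ContinuousLinearMap.ext fun v => ContinuousLinearMap.ext fun w => h _ _ _
  have hφ' := differentiableAt_comp_extChartAt_symm hx (hφ.mdifferentiable (by simp) x)
  have hderiv := ((hφ'.hasFDerivAt.const_mul 2).exp).fun_smul
    (differentiableAt_coordMetric g hx).hasFDerivAt
  rw [hmetric, hderiv.fderiv]
  ext u v w
  simp only [add_apply, smul_apply, ContinuousLinearMap.smulRight_apply, smul_eq_mul, nsmul_eq_mul,
    coordMetric_extChartAt g hx, Function.comp_apply, extChartAt_left_inv 𝓘(ℝ, E) hx]
  push_cast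
  ring

theorem naturalComplexStructure_eq_of_isCompatible (hg : c.IsCompatible g)
    (hg' : c.IsCompatible g') {D D' : LinearConnection E M} (hD : IsLeviCivita g D)
    (hD' : IsLeviCivita g' D') (hJ : J ∈ isometricComplexStructures c) :
    naturalComplexStructure D J = naturalComplexStructure D' J := by
  have hx := mem_chart_source E J.1
  obtain ⟨φ, hφ, h⟩ := hg.conformallyRelated hg'
  have hmetric : metricAt g' J.1 J.1 = Real.exp (2 * φ J.1) • metricAt g J.1 J.1 :=
    ContinuousLinearMap.ext fun v => ContinuousLinearMap.ext fun w => h _ _ _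
  have hsymbol' := hD'.isLeviCivitaSymbol hx
  rw [hmetric, fderiv_coordMetric_of_conformal hφ h hx] at hsymbol'
  refine LinearMap.ext fun w =>
    tangentCoord_injective (mem_chartAt_source_endBundle.2 hx) ?_
  rw [tangentCoord_naturalComplexStructure D hx, tangentCoord_naturalComplexStructure D' hx,
    modelComplexStructure_eq_of_conformal (isMetricForm_metricAt g hx) (hD.isLeviCivitaSymbol hx)
      (Real.exp_ne_zero _) hsymbol' ((mem_isometricComplexStructures_iff_endCoord hg hx).1 hJ)]

end Isometric

/-! ### The tangent spaces of the bundle of isometric complex structures -/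

section Velocity

variable {E : Type*} [NormedAddCommGroup E] [NormedSpace ℝ E]

theorem velocity_mem_anticommutant {A : Type*} [NormedRing A] [NormedAlgebra ℝ A] {α : ℝ → A}
    {b : A} (hα : HasDerivAt α b 0) (h : ∀ᶠ t in 𝓝 0, α t * α t = -1) :
    b ∈ anticommutant ℝ (α 0) := by
  have hconst : HasDerivAt (fun t => α t * α t) 0 0 :=
    (hasDerivAt_const (0 : ℝ) (-1 : A)).congr_of_eventuallyEq h
  exact (add_comm _ _).trans ((hα.mul hα).unique hconst)

theorem velocity_skew_of_isometric {γ : ℝ → E × (E →L[ℝ] E)} {w : E × (E →L[ℝ] E)}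
    (hγ : HasDerivAt γ w 0) {β : E → E →L[ℝ] E →L[ℝ] ℝ} (hβ : DifferentiableAt ℝ β (γ 0).1)
    (h : ∀ᶠ t in 𝓝 0, (γ t).2 ∈ skewEnd (β (γ t).1)) (v z : E) :
    β (γ 0).1 (w.2 v) z + β (γ 0).1 v (w.2 z) =
      -(fderiv ℝ β (γ 0).1 w.1 ((γ 0).2 v) z + fderiv ℝ β (γ 0).1 w.1 v ((γ 0).2 z)) := by
  have hβγ : HasDerivAt (fun t => β (γ t).1) (fderiv ℝ β (γ 0).1 w.1) 0 :=
    hβ.hasFDerivAt.comp_hasDerivAt (0 : ℝ) hγ.fst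
  have hγ2 : HasDerivAt (fun t => (γ t).2) w.2 0 := hγ.snd
  have hγv (v : E) : HasDerivAt (fun t => (γ t).2 v) (w.2 v) 0 := by
    simpa only [map_zero, add_zero] using hγ2.clm_apply (hasDerivAt_const (0 : ℝ) v)
  have hderiv : HasDerivAt (fun t => β (γ t).1 ((γ t).2 v) z + β (γ t).1 v ((γ t).2 z)) _ 0 :=
    ((hβγ.clm_apply (hγv v)).clm_apply (hasDerivAt_const (0 : ℝ) z)).add
      ((hβγ.clm_apply (hasDerivAt_const (0 : ℝ) v)).clm_apply (hγv z))
  have hconst : HasDerivAt (fun t => β (γ t).1 ((γ t).2 v) z + β (γ t).1 v ((γ t).2 z)) 0 0 :=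
    (hasDerivAt_const (0 : ℝ) (0 : ℝ)).congr_of_eventuallyEq (h.mono fun t ht => ht v z)
  have hzero := hderiv.unique hconst
  simp only [add_apply, map_zero, add_zero] at hzero
  linear_combination hzero

theorem velocity_mem_modelTangent {γ : ℝ → E × (E →L[ℝ] E)} {w : E × (E →L[ℝ] E)}
    (hγ : HasDerivAt γ w 0) {β : E → E →L[ℝ] E →L[ℝ] ℝ} (hβ : DifferentiableAt ℝ β (γ 0).1)
    (h : ∀ᶠ t in 𝓝 0, IsIsometricComplex (β (γ t).1) (γ t).2) {Γ : E →L[ℝ] E →L[ℝ] E}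
    (hΓ : ∀ u v z, fderiv ℝ β (γ 0).1 u v z = β (γ 0).1 (Γ u v) z + β (γ 0).1 v (Γ u z)) :
    w ∈ modelTangent (β (γ 0).1) Γ (γ 0).2 := by
  have h0 := h.self_of_nhds
  have hanti := velocity_mem_anticommutant hγ.snd (h.mono fun t ht => ht.sq_eq)
  have hskew := velocity_skew_of_isometric hγ hβ (h.mono fun t ht => ht.mem_skewEnd)
  rw [mem_modelTangent, verticalPart_apply, inducedSymbol_apply]
  refine ⟨add_mem hanti (commutator_mem_anticommutant h0.sq_eq _), fun v z => ?_⟩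
  have hvz := hskew v z
  simp only [hΓ] at hvz
  simp only [add_apply, sub_apply, mul_apply_eq_comp, map_add, map_sub]
  linear_combination hvz - h0.mem_skewEnd (Γ w.1 v) z - h0.mem_skewEnd v (Γ w.1 z)

end Velocity

section Tangent

variable {E : Type*} [NormedAddCommGroup E] [NormedSpace ℝ E] [FiniteDimensional ℝ E]
  {M : Type*} [TopologicalSpace M] [ChartedSpace E M] [IsManifold 𝓘(ℝ, E) ∞ M]
  {c : ConformalStructure E M} {g : RiemMetric E M} {D : LinearConnection E M}
  {q : EndBundle E M} {w : TangentSpace (endModel E) q}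

theorem tangentCoord_velocity_mem_modelTangent (hg : c.IsCompatible g) (hD : IsLeviCivita g D)
    {γ : ℝ → EndBundle E M} (hγ : MDifferentiableAt 𝓘(ℝ, ℝ) (endModel E) γ 0)
    (hγH : ∀ᶠ t in 𝓝 0, γ t ∈ isometricComplexStructures c) :
    tangentCoord (endModel E) (γ 0) (γ 0) (mfderiv 𝓘(ℝ, ℝ) (endModel E) γ 0 (1 : ℝ)) ∈
      modelTangent (metricAt g (γ 0).1 (γ 0).1) (connectionSymbol D (γ 0).1 (γ 0).1)
        (endCoord (γ 0).1 (γ 0).1 (γ 0).2) := by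
  have hx := mem_chart_source E (γ 0).1
  have hsource : ∀ᶠ t in 𝓝 0, γ t ∈ (chartAt (ModelProd E (E →L[ℝ] E)) (γ 0)).source :=
    hγ.continuousAt.eventually
      ((chartAt _ (γ 0)).open_source.mem_nhds (mem_chartAt_source_endBundle.2 hx))
  have hcoord := extChartAt_endBundle (γ 0) (γ 0)
  have h := velocity_mem_modelTangent (β := coordMetric g (γ 0).1)
    (Γ := connectionSymbol D (γ 0).1 (γ 0).1)
    (hasDerivAt_extChartAt_comp (x₀ := γ 0) hγ (mem_chart_source _ _)) ?_ ?_ ?_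
  · simp only [hcoord, coordMetric_extChartAt g hx] at h
    exact h
  · simp only [hcoord]
    exact differentiableAt_coordMetric g hx
  · filter_upwards [hγH, hsource] with t ht hts
    exact (mem_isometricComplexStructures_iff_extChartAt hg
      (mem_chartAt_source_endBundle.1 hts)).1 ht
  · simp only [hcoord, coordMetric_extChartAt g hx]
    exact (hD.isLeviCivitaSymbol hx).metric

theorem tangentCoord_mem_modelTangent (hg : c.IsCompatible g) (hD : IsLeviCivita g D)
    (hw : w ∈ tangentSubspace (endModel E) (isometricComplexStructures c) q) :
    tangentCoord (endModel E) q q w ∈ modelTangent (metricAt g q.1 q.1)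
      (connectionSymbol D q.1 q.1) (endCoord q.1 q.1 q.2) := by
  refine (Submodule.span_le (p := (modelTangent (metricAt g q.1 q.1)
    (connectionSymbol D q.1 q.1) (endCoord q.1 q.1 q.2)).comap
      (tangentCoord (endModel E) q q).toLinearMap)).2 ?_ hw
  rintro v ⟨ε, hε, γ, hγ, hγH, hv⟩
  have hI : Set.Ioo (-ε) ε ∈ 𝓝 (0 : ℝ) := Ioo_mem_nhds (neg_lt_zero.2 hε) hε
  obtain ⟨rfl, hv⟩ := TotalSpace.mk.inj hv
  have hmem := tangentCoord_velocity_mem_modelTangent hg hD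
    ((hγ.contMDiffAt hI).mdifferentiableAt (by simp)) (mem_of_superset hI hγH)
  rw [eq_of_heq hv] at hmem
  exact hmem

/-- The horizontal coordinate and the vertical part identify the vectors whose coordinate
expression is in the model tangent space with the product of `E` and the fibre. -/
theorem finrank_comap_modelTangent_le (β : E →L[ℝ] E →L[ℝ] ℝ) (Γ : E →L[ℝ] E →L[ℝ] E)
    (a : E →L[ℝ] E) (q : EndBundle E M) :
    Module.finrank ℝ
        ((modelTangent β Γ a).comap (tangentCoord (endModel E) q q).toLinearMap) ≤
      Module.finrank ℝ
        ((⊤ : Submodule ℝ E).prod (anticommutant ℝ a ⊓ skewEnd β)) := by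
  let L : TangentSpace (endModel E) q →ₗ[ℝ] E × (E →L[ℝ] E) :=
    ((LinearMap.fst ℝ E (E →L[ℝ] E)).prod (verticalPart Γ a)) ∘ₗ
      (tangentCoord (endModel E) q q).toLinearMap
  refine LinearMap.finrank_le_finrank_of_injective
    (f := L.restrict fun _ hw => ⟨Submodule.mem_top, hw⟩) fun v w hvw => Subtype.ext ?_
  have h : L v = L w := congrArg Subtype.val hvw
  have hfst := congrArg Prod.fst h
  have hsnd := congrArg Prod.snd h
  exact tangentCoord_injective (mem_chart_source _ q) (ext_verticalPart hfst hsnd)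

theorem mem_tangentSubspace_iff (hg : c.IsCompatible g) (hD : IsLeviCivita g D)
    (hq : q ∈ isometricComplexStructures c) :
    w ∈ tangentSubspace (endModel E) (isometricComplexStructures c) q ↔
      tangentCoord (endModel E) q q w ∈ modelTangent (metricAt g q.1 q.1)
        (connectionSymbol D q.1 q.1) (endCoord q.1 q.1 q.2) := by
  refine ⟨tangentCoord_mem_modelTangent hg hD, fun hw => ?_⟩
  have : FiniteDimensional ℝ (TangentSpace (endModel E) q) :=
    inferInstanceAs (FiniteDimensional ℝ (E × (E →L[ℝ] E)))
  obtain ⟨φ, hqφ, hφ⟩ := exists_isSliceChart_isometricComplexStructures hg hq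
  have heq := Submodule.eq_of_le_of_finrank_le
    (fun _ => tangentCoord_mem_modelTangent hg hD)
    ((finrank_comap_modelTangent_le (metricAt g q.1 q.1) (connectionSymbol D q.1 q.1)
      (endCoord q.1 q.1 q.2) q).trans (hφ.finrank_le_finrank_tangentSubspace hqφ hq))
  exact heq ▸ hw

end Tangent

/-! ### The almost complex structure -/

section Structure

variable {E : Type*} [NormedAddCommGroup E] [NormedSpace ℝ E] [FiniteDimensional ℝ E]
  {M : Type*} [TopologicalSpace M] [ChartedSpace E M] [IsManifold 𝓘(ℝ, E) ∞ M]
  {c : ConformalStructure E M} {g : RiemMetric E M} {D : LinearConnection E M}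
  {q : EndBundle E M} {w : TangentSpace (endModel E) q}

theorem naturalComplexStructure_mem_tangentSubspace (hg : c.IsCompatible g)
    (hD : IsLeviCivita g D) (hq : q ∈ isometricComplexStructures c)
    (hw : w ∈ tangentSubspace (endModel E) (isometricComplexStructures c) q) :
    naturalComplexStructure D q w ∈
      tangentSubspace (endModel E) (isometricComplexStructures c) q := by
  have hx := mem_chart_source E q.1
  rw [mem_tangentSubspace_iff hg hD hq] at hw ⊢
  rw [tangentCoord_naturalComplexStructure D hx]
  exact modelComplexStructure_mem_modelTangent
    ((mem_isometricComplexStructures_iff_endCoord hg hx).1 hq) hw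

theorem naturalComplexStructure_naturalComplexStructure (D : LinearConnection E M)
    (hq : q ∈ complexStructures E M) (w : TangentSpace (endModel E) q) :
    naturalComplexStructure D q (naturalComplexStructure D q w) = -w := by
  obtain ⟨⟨X, B⟩, rfl⟩ := (splitting D q).surjective w
  have hB : q.2 ∘L (q.2 ∘L B) = -B := ContinuousLinearMap.ext fun v => hq _
  rw [splitting_apply, naturalComplexStructure_apply, naturalComplexStructure_apply, hB, hq X,
    map_neg, map_neg, neg_add]

/-- The coordinate expression of the natural almost complex structure of the Levi-Civita connection
of `g`, on the tangent space at a point of the chart of `End(TM)` over the chart at `x₀`. -/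
def coordComplexStructure (g : RiemMetric E M) (x₀ : M) (z : E × (E →L[ℝ] E)) :
    E × (E →L[ℝ] E) →L[ℝ] E × (E →L[ℝ] E) :=
  modelComplexStructure
    (christoffel (coordMetric g x₀ z.1) (fderiv ℝ (coordMetric g x₀) z.1)) z.2

theorem contDiffAt_coordComplexStructure (g : RiemMetric E M) {x₀ : M} {z : E × (E →L[ℝ] E)}
    (hz : z.1 ∈ (extChartAt 𝓘(ℝ, E) x₀).target) :
    ContDiffAt ℝ ∞ (coordComplexStructure g x₀) z := by
  have hΓ := (contDiffOn_christoffel (isOpen_extChartAt_target x₀) (isMetricForm_coordMetric g x₀)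
    (contDiffOn_coordMetric g x₀)).contDiffAt ((isOpen_extChartAt_target x₀).mem_nhds hz)
  exact contDiff_modelComplexStructure.contDiffAt.comp z
    ((hΓ.comp z contDiffAt_fst).prodMk contDiffAt_snd)

theorem tangentCoord_naturalComplexStructure_of_isLeviCivita (hD : IsLeviCivita g D)
    {q₀ : EndBundle E M} (hq : q.1 ∈ (chartAt E q₀.1).source) :
    tangentCoord (endModel E) q₀ q (naturalComplexStructure D q w) =
      coordComplexStructure g q₀.1 (extChartAt (endModel E) q₀ q)
        (tangentCoord (endModel E) q₀ q w) := by
  rw [tangentCoord_naturalComplexStructure D hq, extChartAt_endBundle, coordComplexStructure,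
    coordMetric_extChartAt g hq,
    (hD.isLeviCivitaSymbol hq).eq_christoffel (isMetricForm_metricAt g hq)]

/-- `naturalComplexStructure` as a continuous linear map, as smoothness of a field of endomorphisms
requires. -/
def naturalComplexStructureL (D : LinearConnection E M) (q : EndBundle E M) :
    TangentSpace (endModel E) q →L[ℝ] TangentSpace (endModel E) q :=
  let f : E × (E →L[ℝ] E) →ₗ[ℝ] E × (E →L[ℝ] E) := naturalComplexStructure D q
  f.toContinuousLinearMap

theorem contMDiff_naturalComplexStructureL (hD : IsLeviCivita g D) :
    ContMDiff (endModel E)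
      ((endModel E).prod 𝓘(ℝ, E × (E →L[ℝ] E) →L[ℝ] E × (E →L[ℝ] E))) ∞
      (fun q : EndBundle E M => TotalSpace.mk' (E × (E →L[ℝ] E) →L[ℝ] E × (E →L[ℝ] E))
        (E := fun q : EndBundle E M =>
          TangentSpace (endModel E) q →L[ℝ] TangentSpace (endModel E) q)
        q (naturalComplexStructureL D q)) := by
  intro p
  have hp := mem_chart_source E p.1
  rw [contMDiffAt_hom_bundle]
  refine ⟨contMDiffAt_id, ?_⟩
  have hsmooth : ContDiffAt ℝ ∞ (coordComplexStructure g p.1) (extChartAt (endModel E) p p) := by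
    refine contDiffAt_coordComplexStructure g ?_
    rw [extChartAt_endBundle]
    exact mem_extChartAt_target p.1
  refine (hsmooth.contMDiffAt.comp p contMDiffAt_extChartAt).congr_of_eventuallyEq ?_
  filter_upwards [(chartAt _ p).open_source.mem_nhds (mem_chartAt_source_endBundle.2 hp)] with q hq
  refine ContinuousLinearMap.ext fun w => ?_
  have h := tangentCoord_naturalComplexStructure_of_isLeviCivita hD
    (w := tangentCoordSymm (endModel E) p q w) (mem_chartAt_source_endBundle.1 hq)
  rw [tangentCoord_tangentCoordSymm hq] at h
  exact h

/-- The almost complex structure of the bundle of isometric complex structures, computed with a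
compatible metric and its Levi-Civita connection. -/
def twistorStructure (hg : c.IsCompatible g) (hD : IsLeviCivita g D) :
    AlmostComplexStructureOn (endModel E) (isometricComplexStructures c) where
  toFun q := (naturalComplexStructure D q).restrict fun _ hw =>
    naturalComplexStructure_mem_tangentSubspace hg hD q.2 hw
  sq_eq_neg q v := Subtype.ext (naturalComplexStructure_naturalComplexStructure D q.2.1 v)
  smooth _ := ⟨Set.univ, isOpen_univ, Set.mem_univ _, naturalComplexStructureL D,
    (contMDiff_naturalComplexStructureL hD).contMDiffOn, fun _ _ _ => rfl⟩

end Structure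

end ConformalTwistor

end

theorem mainTheorem8_general {E : Type*} [NormedAddCommGroup E] [NormedSpace ℝ E]
    [FiniteDimensional ℝ E] {M : Type*} [TopologicalSpace M] [ChartedSpace E M]
    [IsManifold 𝓘(ℝ, E) ∞ M] (c : ConformalStructure E M) :
    (∀ g g' : RiemMetric E M, c.IsCompatible g → c.IsCompatible g' →
      ∀ D D' : LinearConnection E M, IsLeviCivita g D → IsLeviCivita g' D' →
        ∀ J ∈ isometricComplexStructures c,
          naturalComplexStructure D J = naturalComplexStructure D' J) ∧
    IsEmbeddedSubmanifold (endModel E) (isometricComplexStructures c) ∧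
    ∃! j : AlmostComplexStructureOn (endModel E) (isometricComplexStructures c),
      ∀ g : RiemMetric E M, c.IsCompatible g →
        ∀ D : LinearConnection E M, IsLeviCivita g D →
          ∀ (J : isometricComplexStructures c)
            (v : tangentSubspace (endModel E) (isometricComplexStructures c) (J : EndBundle E M)),
            (j.toFun J v : TangentSpace (endModel E) (J : EndBundle E M)) =
              naturalComplexStructure D J v := by
  refine ⟨fun g g' hg hg' D D' hD hD' J hJ =>
    naturalComplexStructure_eq_of_isCompatible hg hg' hD hD' hJ,
    isEmbeddedSubmanifold_isometricComplexStructures c, ?_⟩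
  obtain ⟨g, hg⟩ := c.exists_isCompatible
  obtain ⟨D, hD⟩ := exists_isLeviCivita g
  refine ⟨twistorStructure hg hD, fun g' hg' D' hD' J v => ?_, ?_⟩
  · exact DFunLike.congr_fun (naturalComplexStructure_eq_of_isCompatible hg hg' hD hD' J.2)
      (v : TangentSpace (endModel E) (J : EndBundle E M))
  · rintro ⟨f, hf, hs⟩ h
    obtain rfl : f = (twistorStructure hg hD).toFun :=
      funext fun J => LinearMap.ext fun v => Subtype.ext (h g hg D hD J v)
    rfl

theorem mainTheorem8 {ℓ : ℕ} {E : Type*} [NormedAddCommGroup E] [NormedSpace ℝ E]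
    [FiniteDimensional ℝ E] (hE : Module.finrank ℝ E = 2 * ℓ)
    {M : Type*} [TopologicalSpace M] [T2Space M] [SecondCountableTopology M]
    [ChartedSpace E M] [IsManifold 𝓘(ℝ, E) ∞ M]
    (c : ConformalStructure E M) :
    (∀ g g' : RiemMetric E M, c.IsCompatible g → c.IsCompatible g' →
      ∀ D D' : LinearConnection E M, IsLeviCivita g D → IsLeviCivita g' D' →
        ∀ J ∈ isometricComplexStructures c,
          ∀ v ∈ tangentSubspace (endModel E) (complexStructures E M) J,
            naturalComplexStructure D J v = naturalComplexStructure D' J v) ∧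
    IsEmbeddedSubmanifold (endModel E) (isometricComplexStructures c) ∧
    ∃! j : AlmostComplexStructureOn (endModel E) (isometricComplexStructures c),
      ∀ g : RiemMetric E M, c.IsCompatible g →
        ∀ D : LinearConnection E M, IsLeviCivita g D →
          ∀ (J : isometricComplexStructures c)
            (v : tangentSubspace (endModel E) (isometricComplexStructures c) (J : EndBundle E M)),
            (j.toFun J v : TangentSpace (endModel E) (J : EndBundle E M)) =
              naturalComplexStructure D J v :=
  ⟨fun g g' hg hg' D D' hD hD' J hJ v _ => DFunLike.congr_fun
    ((mainTheorem8_general c).1 g g' hg hg' D D' hD hD' J hJ) v, (mainTheorem8_general c).2⟩
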